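/- Let $\Gamma$ be a finite simple graph and let $A_\Gamma$ be the associated right-angled Artin group, with one generator for each vertex of $\Gamma$ and the relation $[u,v]=1$ for each edge $\{u,v\}$. Let $\gamma_1(A_\Gamma)=A_\Gamma$ and $\gamma_{c+1}(A_\Gamma)=[\gamma_c(A_\Gamma),A_\Gamma]$ be the lower central series, let $L_c=\gamma_c(A_\Gamma)/\gamma_{c+1}(A_\Gamma)$ for $c\ge 1$, and let $L=\bigoplus_{c\ge 1}L_c$ be the associated graded Lie ring over $\mathbb{Z}$, whose bracket is induced by taking commutators in $A_\Gamma$. For a positive integer $p$ let $(L)_p=(\mathbb{Z}/p\mathbb{Z})\otimes_{\mathbb{Z}}L$, and for $c\ge 1$ let $L^c=L/\bigoplus_{i>c}L_i$. Write $Z(\cdot)$ for the centre of a group or of a Lie algebra. If $Z(A_\Gamma)=\{1\}$, then $Z(L)=0$; $Z((L)_p)=0$ for every positive integer $p$; and for every $c\ge 1$ the centre $Z(L^c)$ is exactly the image of $L_c$ under the quotient map $L\to L^c$. -/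

import Mathlib

open scoped DirectSum TensorProduct commutatorElement

/-! ### Right-angled Artin groups -/

/-- The right-angled Artin group `A_Γ`: one generator for each vertex of `Γ`, and the relation
`[u, v] = 1` for each edge `{u, v}`. -/
def RAAG {V : Type*} (Γ : SimpleGraph V) : Type _ :=
  PresentedGroup {r : FreeGroup V | ∃ u v, Γ.Adj u v ∧ r = ⁅FreeGroup.of u, FreeGroup.of v⁆}

instance {V : Type*} (Γ : SimpleGraph V) : Group (RAAG Γ) :=
  inferInstanceAs (Group (PresentedGroup _))

/-! ### The lower central series, starting at `γ_1 = G` -/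

section LowerCentral

variable (G : Type*) [Group G]

/-- The `c`-th term of the lower central series: `γ_1 = G` and `γ_{c+1} = [γ_c, G]`. -/
def lcs (c : ℕ+) : Subgroup G := (⊤ : Subgroup G).lowerCentralSeries ((c : ℕ) - 1)

theorem lcs_one : lcs G 1 = ⊤ := rfl

theorem lcs_add_one (c : ℕ+) : lcs G (c + 1) = ⁅lcs G c, (⊤ : Subgroup G)⁆ := by
  obtain ⟨n, rfl⟩ : ∃ n : ℕ, c = n.succPNat := ⟨c.natPred, (PNat.succPNat_natPred c).symm⟩
  rfl

instance lcs_normal (c : ℕ+) : (lcs G c).Normal := by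
  unfold lcs; infer_instance

theorem lcs_antitone : Antitone (lcs G) := fun _ _ h =>
  Subgroup.lowerCentralSeries_antitone _ (Nat.sub_le_sub_right h 1)

variable {G}

/-- The three subgroups lemma modulo a normal subgroup. -/
theorem three_subgroups_le {A B C N : Subgroup G} [N.Normal]
    (h1 : ⁅⁅B, C⁆, A⁆ ≤ N) (h2 : ⁅⁅C, A⁆, B⁆ ≤ N) : ⁅⁅A, B⁆, C⁆ ≤ N := by
  have key : ∀ K : Subgroup G, K ≤ N ↔ K.map (QuotientGroup.mk' N) = ⊥ := fun K => by
    rw [Subgroup.map_eq_bot_iff, QuotientGroup.ker_mk']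
  rw [key, Subgroup.map_commutator, Subgroup.map_commutator] at h1 h2 ⊢
  exact Subgroup.commutator_commutator_eq_bot_of_rotate h1 h2

theorem commutator_lcs_le (i j : ℕ+) : ⁅lcs G i, lcs G j⁆ ≤ lcs G (i + j) := by
  induction j using PNat.recOn generalizing i with
  | one => rw [lcs_add_one, lcs_one]
  | succ j ih =>
    rw [lcs_add_one G j, Subgroup.commutator_comm]
    apply three_subgroups_le
    · rw [Subgroup.commutator_comm ⊤ (lcs G i), ← lcs_add_one]
      refine (ih (i + 1)).trans (le_of_eq ?_)
      rw [add_right_comm, add_assoc]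
    · rw [← add_assoc, lcs_add_one G (i + j)]
      exact Subgroup.commutator_mono (ih i) le_rfl

theorem commutatorElement_mem_lcs {i j : ℕ+} {x y : G} (hx : x ∈ lcs G i) (hy : y ∈ lcs G j) :
    ⁅x, y⁆ ∈ lcs G (i + j) :=
  commutator_lcs_le i j (Subgroup.commutator_mem_commutator hx hy)

theorem conj_mul_inv_mem_lcs {i : ℕ+} (x : G) {y : G} (hy : y ∈ lcs G i) :
    x * y * x⁻¹ * y⁻¹ ∈ lcs G (i + 1) := by
  rw [← commutatorElement_def, add_comm]
  exact commutatorElement_mem_lcs (i := 1) (Subgroup.mem_top x) hy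

end LowerCentral

/-! ### The graded pieces `L_c = γ_c / γ_{c+1}` -/

section Pieces

variable (G : Type*) [Group G]

/-- The group `L_c = γ_c / γ_{c+1}`, written additively. -/
def LcsQuot (c : ℕ+) : Type _ := Additive (lcs G c ⧸ (lcs G (c + 1)).subgroupOf (lcs G c))

instance (c : ℕ+) : AddGroup (LcsQuot G c) :=
  inferInstanceAs (AddGroup (Additive (lcs G c ⧸ (lcs G (c + 1)).subgroupOf (lcs G c))))

variable {G}

/-- The class in `L_c` of an element of `γ_c`. -/
def LcsQuot.mk {c : ℕ+} (x : lcs G c) : LcsQuot G c :=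
  Additive.ofMul (QuotientGroup.mk x)

theorem LcsQuot.mk_surjective {c : ℕ+} : Function.Surjective (LcsQuot.mk (G := G) (c := c)) :=
  fun a => QuotientGroup.mk_surjective (Additive.toMul a)

theorem LcsQuot.mk_mul {c : ℕ+} (x y : lcs G c) :
    LcsQuot.mk (x * y) = LcsQuot.mk x + LcsQuot.mk y := rfl

theorem LcsQuot.mk_one {c : ℕ+} : LcsQuot.mk (1 : lcs G c) = 0 := rfl

theorem LcsQuot.mk_eq_iff {c : ℕ+} (x y : lcs G c) :
    LcsQuot.mk x = LcsQuot.mk y ↔ (x : G) * (y : G)⁻¹ ∈ lcs G (c + 1) := by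
  have h : LcsQuot.mk x = LcsQuot.mk y ↔
      (x : G)⁻¹ * (y : G) ∈ lcs G (c + 1) := by
    refine (QuotientGroup.eq (s := (lcs G (c + 1)).subgroupOf (lcs G c))).trans ?_
    rw [Subgroup.mem_subgroupOf]; rfl
  rw [h, ← inv_mem_iff, mul_inv_rev, inv_inv, (lcs_normal G (c + 1)).mem_comm_iff]

instance (c : ℕ+) : AddCommGroup (LcsQuot G c) where
  add_comm a b := by
    obtain ⟨x, rfl⟩ := LcsQuot.mk_surjective a
    obtain ⟨y, rfl⟩ := LcsQuot.mk_surjective b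
    rw [← LcsQuot.mk_mul, ← LcsQuot.mk_mul, LcsQuot.mk_eq_iff]
    have := conj_mul_inv_mem_lcs (x : G) y.2
    simpa [mul_assoc] using this

/-- The commutator of `x ∈ γ_i` and `y ∈ γ_j`, as an element of `γ_{i+j}`. -/
def lcsCommutator {i j : ℕ+} (x : lcs G i) (y : lcs G j) : lcs G (i + j) :=
  ⟨⁅(x : G), (y : G)⁆, commutatorElement_mem_lcs x.2 y.2⟩

theorem mk_lcsCommutator_mul_left {i j : ℕ+} (x x' : lcs G i) (y : lcs G j) :
    LcsQuot.mk (lcsCommutator (x * x') y) =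
      LcsQuot.mk (lcsCommutator x y) + LcsQuot.mk (lcsCommutator x' y) := by
  rw [add_comm (LcsQuot.mk (lcsCommutator x y)), ← LcsQuot.mk_mul, LcsQuot.mk_eq_iff]
  have := conj_mul_inv_mem_lcs (x : G) (lcsCommutator x' y).2
  simpa [lcsCommutator, commutatorElement_mul_left_eq_conj_mul, mul_assoc,
    -commutatorElement_inv] using this

theorem mk_lcsCommutator_mul_right {i j : ℕ+} (x : lcs G i) (y y' : lcs G j) :
    LcsQuot.mk (lcsCommutator x (y * y')) =
      LcsQuot.mk (lcsCommutator x y) + LcsQuot.mk (lcsCommutator x y') := by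
  rw [← LcsQuot.mk_mul, LcsQuot.mk_eq_iff]
  have := (lcs_normal G (i + j + 1)).conj_mem _
    (conj_mul_inv_mem_lcs (y : G) (lcsCommutator x y').2) (lcsCommutator x y : G)
  simpa [lcsCommutator, commutatorElement_mul_right_eq_mul_conj, mul_assoc] using this

theorem mk_lcsCommutator_congr_left {i j : ℕ+} {x x' : lcs G i} (y : lcs G j)
    (h : LcsQuot.mk x = LcsQuot.mk x') :
    LcsQuot.mk (lcsCommutator x y) = LcsQuot.mk (lcsCommutator x' y) := by
  have e : x = (x * x'⁻¹) * x' := by simp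
  rw [e, mk_lcsCommutator_mul_left, add_eq_right, ← LcsQuot.mk_one, LcsQuot.mk_eq_iff]
  rw [LcsQuot.mk_eq_iff] at h
  have := commutatorElement_mem_lcs h y.2
  rw [add_right_comm] at this
  simpa [lcsCommutator] using this

theorem mk_lcsCommutator_congr_right {i j : ℕ+} (x : lcs G i) {y y' : lcs G j}
    (h : LcsQuot.mk y = LcsQuot.mk y') :
    LcsQuot.mk (lcsCommutator x y) = LcsQuot.mk (lcsCommutator x y') := by
  have e : y = (y * y'⁻¹) * y' := by simp
  rw [e, mk_lcsCommutator_mul_right, add_eq_right, ← LcsQuot.mk_one, LcsQuot.mk_eq_iff]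
  rw [LcsQuot.mk_eq_iff] at h
  have := commutatorElement_mem_lcs x.2 h
  rw [← add_assoc] at this
  simpa [lcsCommutator] using this

/-- The bracket `L_i × L_j → L_{i+j}` induced by the commutator of `G`. -/
def LcsQuot.bracket {i j : ℕ+} : LcsQuot G i →+ LcsQuot G j →+ LcsQuot G (i + j) :=
  AddMonoidHom.mk'
    (fun a => AddMonoidHom.mk'
      (fun b => Quotient.liftOn₂' (Additive.toMul a) (Additive.toMul b)
        (fun x y => LcsQuot.mk (lcsCommutator x y))
        (fun _ y x' _ hx hy =>
          (mk_lcsCommutator_congr_left y (congrArg Additive.ofMul (Quotient.sound' hx))).trans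
          (mk_lcsCommutator_congr_right x' (congrArg Additive.ofMul (Quotient.sound' hy)))))
      (fun b b' => by
        obtain ⟨x, rfl⟩ := LcsQuot.mk_surjective a
        obtain ⟨y, rfl⟩ := LcsQuot.mk_surjective b
        obtain ⟨y', rfl⟩ := LcsQuot.mk_surjective b'
        exact mk_lcsCommutator_mul_right x y y'))
    (fun a a' => by
      refine AddMonoidHom.ext fun b => ?_
      obtain ⟨x, rfl⟩ := LcsQuot.mk_surjective a
      obtain ⟨x', rfl⟩ := LcsQuot.mk_surjective a'
      obtain ⟨y, rfl⟩ := LcsQuot.mk_surjective b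
      exact mk_lcsCommutator_mul_left x x' y)

theorem LcsQuot.bracket_mk {i j : ℕ+} (x : lcs G i) (y : lcs G j) :
    LcsQuot.bracket (LcsQuot.mk x) (LcsQuot.mk y) = LcsQuot.mk (lcsCommutator x y) := rfl

end Pieces

/-! ### The graded Lie ring `L = ⨁_{c ≥ 1} L_c` -/

section Graded

variable (G : Type*) [Group G]

/-- The graded abelian group `L = ⨁_{c ≥ 1} γ_c / γ_{c+1}`. -/
def LcsLie : Type _ := ⨁ c : ℕ+, LcsQuot G c

instance : AddCommGroup (LcsLie G) := inferInstanceAs (AddCommGroup (⨁ c : ℕ+, LcsQuot G c))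

variable {G}

namespace LcsLie

/-- The inclusion `L_c → L`. -/
def of (c : ℕ+) : LcsQuot G c →+ LcsLie G := DirectSum.of (LcsQuot G) c

theorem induction {P : LcsLie G → Prop} (x : LcsLie G) (zero : P 0)
    (of : ∀ c (a : LcsQuot G c), P (of c a)) (add : ∀ x y, P x → P y → P (x + y)) : P x :=
  DirectSum.induction_on x zero of add

theorem of_mk_congr {c d : ℕ+} (h : c = d) {x : lcs G c} {y : lcs G d} (hxy : (x : G) = y) :
    of c (LcsQuot.mk x) = of d (LcsQuot.mk y) := by
  subst h
  rw [Subtype.ext hxy]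

/-- The additive map on `L` with prescribed restrictions to the `L_c`. -/
def lift {A : Type*} [AddCommGroup A] (f : ∀ c : ℕ+, LcsQuot G c →+ A) : LcsLie G →+ A :=
  DirectSum.toAddMonoid f

theorem lift_of {A : Type*} [AddCommGroup A] (f : ∀ c : ℕ+, LcsQuot G c →+ A) (c : ℕ+)
    (a : LcsQuot G c) : lift f (of c a) = f c a :=
  DirectSum.toAddMonoid_of f c a

/-- The biadditive extension to `L` of the brackets `L_i × L_j → L_{i+j}`. -/
def bracketHom : LcsLie G →+ LcsLie G →+ LcsLie G :=
  lift fun i =>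
    AddMonoidHom.flip <|
      lift fun j =>
        AddMonoidHom.flip <|
          (AddMonoidHom.compHom (of (i + j))).comp LcsQuot.bracket

theorem bracketHom_of_of {i j : ℕ+} (a : LcsQuot G i) (b : LcsQuot G j) :
    bracketHom (of i a) (of j b) = of (i + j) (LcsQuot.bracket a b) := by
  unfold bracketHom
  rw [lift_of, AddMonoidHom.flip_apply, lift_of]
  rfl

theorem bracketHom_skew (x y : LcsLie G) : bracketHom x y + bracketHom y x = 0 := by
  induction x using LcsLie.induction with
  | zero => simp
  | add x x' hx hx' =>
    simp only [map_add, AddMonoidHom.add_apply]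
    rw [add_add_add_comm, hx, hx', add_zero]
  | of i a =>
    induction y using LcsLie.induction with
    | zero => simp
    | add y y' hy hy' =>
      simp only [map_add, AddMonoidHom.add_apply]
      rw [add_add_add_comm, hy, hy', add_zero]
    | of j b =>
      obtain ⟨x, rfl⟩ := LcsQuot.mk_surjective a
      obtain ⟨y, rfl⟩ := LcsQuot.mk_surjective b
      rw [bracketHom_of_of, bracketHom_of_of, LcsQuot.bracket_mk, LcsQuot.bracket_mk]
      have : of (j + i) (LcsQuot.mk (lcsCommutator y x)) =
          of (i + j) (LcsQuot.mk ((lcsCommutator x y)⁻¹)) :=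
        of_mk_congr (add_comm j i) (by simp [lcsCommutator])
      rw [this, ← map_add, ← LcsQuot.mk_mul, mul_inv_cancel, LcsQuot.mk_one, map_zero]

theorem bracketHom_self (x : LcsLie G) : bracketHom x x = 0 := by
  induction x using LcsLie.induction with
  | zero => simp
  | add x y hx hy =>
    simp only [map_add, AddMonoidHom.add_apply]
    rw [hx, hy, zero_add, add_zero, add_comm, bracketHom_skew]
  | of i a =>
    obtain ⟨x, rfl⟩ := LcsQuot.mk_surjective a
    rw [bracketHom_of_of, LcsQuot.bracket_mk]
    have : lcsCommutator x x = 1 := Subtype.ext (commutatorElement_self (x : G))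
    rw [this, LcsQuot.mk_one, map_zero]

theorem bracketHom_jacobi_of {i j k : ℕ+} (x : lcs G i) (y : lcs G j) (z : lcs G k) :
    bracketHom (bracketHom (of i (LcsQuot.mk x)) (of j (LcsQuot.mk y))) (of k (LcsQuot.mk z)) +
    bracketHom (bracketHom (of j (LcsQuot.mk y)) (of k (LcsQuot.mk z))) (of i (LcsQuot.mk x)) +
    bracketHom (bracketHom (of k (LcsQuot.mk z)) (of i (LcsQuot.mk x))) (of j (LcsQuot.mk y)) =
      0 := by
  have conj : ∀ {c : ℕ+} (g : G) (w : lcs G c), LcsQuot.mk w =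
      LcsQuot.mk ⟨g * w * g⁻¹, (lcs_normal G c).conj_mem _ w.2 g⟩ := fun g w =>
    ((LcsQuot.mk_eq_iff _ _).2 (conj_mul_inv_mem_lcs g w.2)).symm
  simp only [bracketHom_of_of, LcsQuot.bracket_mk]
  rw [mk_lcsCommutator_congr_right (lcsCommutator x y) (conj (y : G) z),
    mk_lcsCommutator_congr_right (lcsCommutator y z) (conj (z : G) x),
    mk_lcsCommutator_congr_right (lcsCommutator z x) (conj (x : G) y)]
  have hw := commutatorElement_commutatorElement_conj_mul (x : G) (y : G) (z : G)
  have m2 := commutatorElement_mem_lcs (commutatorElement_mem_lcs y.2 z.2)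
    ((lcs_normal G i).conj_mem _ x.2 (z : G))
  have m3 := commutatorElement_mem_lcs (commutatorElement_mem_lcs z.2 x.2)
    ((lcs_normal G j).conj_mem _ y.2 (x : G))
  have e2 : j + k + i = i + j + k := by rw [add_comm, add_assoc]
  have e3 : k + i + j = i + j + k := by rw [add_assoc, add_comm]
  have f2 : of (j + k + i) (LcsQuot.mk (lcsCommutator (lcsCommutator y z)
      ⟨z * x * (z : G)⁻¹, (lcs_normal G i).conj_mem _ x.2 (z : G)⟩)) =
      of (i + j + k) (LcsQuot.mk ⟨_, e2 ▸ m2⟩) := of_mk_congr e2 rfl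
  have f3 : of (k + i + j) (LcsQuot.mk (lcsCommutator (lcsCommutator z x)
      ⟨x * y * (x : G)⁻¹, (lcs_normal G j).conj_mem _ y.2 (x : G)⟩)) =
      of (i + j + k) (LcsQuot.mk ⟨_, e3 ▸ m3⟩) := of_mk_congr e3 rfl
  rw [f2, f3, ← map_add, ← map_add, ← LcsQuot.mk_mul, ← LcsQuot.mk_mul]
  rw [← map_zero (of (i + j + k)), ← LcsQuot.mk_one]
  congr 2
  exact Subtype.ext hw

theorem bracketHom_jacobi (x y z : LcsLie G) :
    bracketHom (bracketHom x y) z + bracketHom (bracketHom y z) x +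
      bracketHom (bracketHom z x) y = 0 := by
  induction x using LcsLie.induction with
  | zero => simp
  | add x x' hx hx' =>
    simp only [map_add, AddMonoidHom.add_apply]
    rw [← add_zero (0 : LcsLie G)]
    nth_rw 1 [← hx]
    rw [← hx']
    abel
  | of i a =>
    induction y using LcsLie.induction with
    | zero => simp
    | add x x' hx hx' =>
      simp only [map_add, AddMonoidHom.add_apply]
      rw [← add_zero (0 : LcsLie G)]
      nth_rw 1 [← hx]
      rw [← hx']
      abel
    | of j b =>
      induction z using LcsLie.induction with
      | zero => simp
      | add x x' hx hx' =>
        simp only [map_add, AddMonoidHom.add_apply]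
        rw [← add_zero (0 : LcsLie G)]
        nth_rw 1 [← hx]
        rw [← hx']
        abel
      | of k c =>
        obtain ⟨x, rfl⟩ := LcsQuot.mk_surjective a
        obtain ⟨y, rfl⟩ := LcsQuot.mk_surjective b
        obtain ⟨z, rfl⟩ := LcsQuot.mk_surjective c
        exact bracketHom_jacobi_of x y z

/-- `L` is a Lie ring, with the bracket induced by commutators of `G`. -/
instance : LieRing (LcsLie G) where
  bracket x y := bracketHom x y
  add_lie x y z := by
    change bracketHom (x + y) z = bracketHom x z + bracketHom y z
    rw [map_add, AddMonoidHom.add_apply]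
  lie_add x y z := map_add (bracketHom x) y z
  lie_self := bracketHom_self
  leibniz_lie x y z := by
    change bracketHom x (bracketHom y z) =
      bracketHom (bracketHom x y) z + bracketHom y (bracketHom x z)
    have h := bracketHom_jacobi x y z
    have h1 := eq_neg_of_add_eq_zero_left (bracketHom_skew x (bracketHom y z))
    have h2 := eq_neg_of_add_eq_zero_left (bracketHom_skew y (bracketHom x z))
    have h3 := eq_neg_of_add_eq_zero_left (bracketHom_skew z x)
    rw [h3, map_neg, AddMonoidHom.neg_apply] at h
    rw [h1, h2, neg_eq_iff_add_eq_zero, ← h]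
    abel

theorem lie_of_of {i j : ℕ+} (a : LcsQuot G i) (b : LcsQuot G j) :
    ⁅of i a, of j b⁆ = of (i + j) (LcsQuot.bracket a b) :=
  bracketHom_of_of a b

/-- The bracket of the classes of `x ∈ γ_i` and `y ∈ γ_j` is the class of `[x, y]` in `L_{i+j}`. -/
theorem lie_of_mk_of_mk {i j : ℕ+} (x : lcs G i) (y : lcs G j) :
    ⁅of i (LcsQuot.mk x), of j (LcsQuot.mk y)⁆ =
      of (i + j) (LcsQuot.mk ⟨⁅(x : G), (y : G)⁆, commutatorElement_mem_lcs x.2 y.2⟩) :=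
  lie_of_of _ _

variable (G)

/-- The degree `c` part `L_c`, as a `ℤ`-submodule of `L`. -/
def degreePart (c : ℕ+) : Submodule ℤ (LcsLie G) := LinearMap.range (of c).toIntLinearMap

/-- The direct sum of the `L_i` with `i > c`, inside `L`. -/
def tailSubmodule (c : ℕ+) : Submodule ℤ (LcsLie G) := ⨆ i > c, degreePart G i

theorem lie_mem_tailSubmodule (c : ℕ+) (x m : LcsLie G) (hm : m ∈ tailSubmodule G c) :
    ⁅x, m⁆ ∈ tailSubmodule G c := by
  suffices h : tailSubmodule G c ≤
      (tailSubmodule G c).comap (bracketHom x).toIntLinearMap from h hm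
  refine iSup₂_le fun j hj => ?_
  rintro _ ⟨b, rfl⟩
  change bracketHom x (of j b) ∈ tailSubmodule G c
  induction x using LcsLie.induction with
  | zero => simp
  | add x y hx hy =>
    rw [map_add, AddMonoidHom.add_apply]
    exact add_mem hx hy
  | of i a =>
    rw [bracketHom_of_of]
    exact Submodule.mem_iSup_of_mem (i + j) (Submodule.mem_iSup_of_mem
      (lt_trans hj (PNat.lt_add_left j i)) ⟨_, rfl⟩)

/-- The ideal of `L` that is the direct sum of the `L_i` with `i > c`. -/
def tail (c : ℕ+) : LieIdeal ℤ (LcsLie G) where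
  __ := tailSubmodule G c
  lie_mem {x m} hm := lie_mem_tailSubmodule G c x m hm

/-- The truncation `L^c`: the quotient of `L` by the direct sum of the `L_i` with `i > c`. -/
abbrev Truncation (c : ℕ+) : Type _ := LcsLie G ⧸ tail G c

/-- The quotient map `L → L^c`. -/
def toTruncation (c : ℕ+) : LcsLie G →ₗ[ℤ] Truncation G c :=
  (LieSubmodule.Quotient.mk' (tail G c) : LcsLie G →ₗ[ℤ] Truncation G c)

end LcsLie

end Graded

/-!
Let `M` be the trace monoid of `Γ`, the monoid with one generator for each vertex and the same
commutations as `A_Γ`. The Magnus homomorphism `v ↦ 1 + v X` maps `A_Γ` to the units of the ring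
of power series over `ℤ[M]`, and its leading terms define a homomorphism of Lie rings `Φ : L → ℤ[M]`
that sends the class of the generator `v` to `v` (`RAAG.magnusLie`). Two facts about `Φ` give the
theorem.

*The centre of `ℤ/n[M]` is small.* If no vertex is adjacent to all others, an element of `R[M]` that
commutes with every vertex is a constant (`coeff_eq_zero_of_commute_of`). For if `m` lies in the
support of such an element then, as `M` is cancellative, `v ^ k * m = m' * v ^ k` for all `v` and
`k` and some `m'`; projecting to the free monoid on `v` and a non-adjacent `w` shows that `w` does
not occur in `m`. A vertex adjacent to all others would be a nontrivial central element of `A_Γ`,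
so the hypothesis on the centre excludes it. Since `Φ` has values in the augmentation ideal, an
element of `L` that commutes modulo `n` with the generators has image in `n ℤ[M]`.

*The image of `Φ` is pure.* If `Φ x ∈ n ℤ[M]` with `n > 0` then `x ∈ n L`, and `Φ` is injective on
each `L_c`. It suffices to treat a prime `n = q`. The Lie algebra `𝔤 = 𝔽_q ⊗ L^c` is
finite-dimensional and solvable, and such a Lie algebra embeds in its enveloping algebra
(`ι_injective_of_isSolvable`); this case of the Poincaré–Birkhoff–Witt theorem follows by induction
on the dimension, because a Lie algebra with an ideal `A` of codimension one acts on the enveloping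
algebra of `A`. As `L` is generated by `L_1`, the map `L → 𝔤 → U(𝔤)` factors through `Φ`, and
therefore kills `x` (`RAAG.exists_eq_prime_smul`). Finally the kernel of `Φ` on `L_c` is a finitely
generated abelian group divisible by all primes, hence zero.

The three assertions are then obtained with `n = 0`, `n = p` and `n = 0`. For the first and the
third one looks at the homogeneous components of an element that commutes with the generators, in
`L` or modulo the components of degree greater than `c`.
-/

section

attribute [local instance] LieRing.ofAssociativeRing

/-! ### Finite-dimensional solvable Lie algebras embed in their enveloping algebras -/

section Enveloping

open UniversalEnvelopingAlgebra

variable {k L : Type*} [Field k] [LieRing L] [LieAlgebra k L]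

/-- A derivation `d` of a Lie algebra extends to its enveloping algebra `U`. Only the Leibniz rule
for products whose left factor comes from the Lie algebra is recorded. The extension is the second
component of the algebra map `U → U[ε]` that lifts `a ↦ ι a + ε ι (d a)`. -/
theorem exists_derivation_extension {A : Type*} [LieRing A] [LieAlgebra k A]
    (d : LieDerivation k A A) :
    ∃ D : UniversalEnvelopingAlgebra k A →ₗ[k] UniversalEnvelopingAlgebra k A,
      ∀ a u, D (ι k a * u) = ι k (d a) * u + ι k a * D u := by
  let f : A →ₗ⁅k⁆ DualNumber (UniversalEnvelopingAlgebra k A) :=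
    { toFun := fun a => TrivSqZeroExt.inl (ι k a) + TrivSqZeroExt.inr (ι k (d a))
      map_add' := fun a b => by
        refine TrivSqZeroExt.ext ?_ ?_ <;>
          simp only [map_add, TrivSqZeroExt.fst_add, TrivSqZeroExt.snd_add, TrivSqZeroExt.fst_inl,
            TrivSqZeroExt.snd_inl, TrivSqZeroExt.fst_inr, TrivSqZeroExt.snd_inr, add_zero, zero_add]
      map_smul' := fun c a => by
        refine TrivSqZeroExt.ext ?_ ?_ <;>
          simp only [map_smul, TrivSqZeroExt.fst_add, TrivSqZeroExt.snd_add, TrivSqZeroExt.fst_inl,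
            TrivSqZeroExt.snd_inl, TrivSqZeroExt.fst_inr, TrivSqZeroExt.snd_inr, add_zero, zero_add,
            TrivSqZeroExt.fst_smul, TrivSqZeroExt.snd_smul, RingHom.id_apply]
      map_lie' := fun {a b} => by
        rw [LieRing.of_associative_ring_bracket, LieDerivation.apply_lie_eq_sub, map_sub,
          LieHom.map_lie, LieHom.map_lie, LieHom.map_lie]
        simp only [LieRing.of_associative_ring_bracket]
        refine TrivSqZeroExt.ext ?_ ?_ <;>
          simp only [TrivSqZeroExt.fst_sub, TrivSqZeroExt.snd_sub, TrivSqZeroExt.fst_mul,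
            TrivSqZeroExt.snd_mul, TrivSqZeroExt.fst_add, TrivSqZeroExt.snd_add,
            TrivSqZeroExt.fst_inl, TrivSqZeroExt.snd_inl, TrivSqZeroExt.fst_inr,
            TrivSqZeroExt.snd_inr, add_zero, zero_add, smul_eq_mul, MulOpposite.smul_eq_mul_unop,
            MulOpposite.unop_op]
        abel }
  have hf1 : ∀ a, (f a).fst = ι k a := fun a => by
    change (TrivSqZeroExt.inl (ι k a) + TrivSqZeroExt.inr (ι k (d a))).fst = _
    simp only [TrivSqZeroExt.fst_add, TrivSqZeroExt.fst_inl, TrivSqZeroExt.fst_inr, add_zero]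
  have hf2 : ∀ a, (f a).snd = ι k (d a) := fun a => by
    change (TrivSqZeroExt.inl (ι k a) + TrivSqZeroExt.inr (ι k (d a))).snd = _
    simp only [TrivSqZeroExt.snd_add, TrivSqZeroExt.snd_inl, TrivSqZeroExt.snd_inr, zero_add]
  have hfst : ∀ u, (lift k f u).fst = u := by
    have h : (TrivSqZeroExt.fstHom k (UniversalEnvelopingAlgebra k A)
        (UniversalEnvelopingAlgebra k A)).comp (lift k f) = AlgHom.id k _ := by
      refine hom_ext k (LieHom.ext fun a => ?_)
      change (lift k f (ι k a)).fst = ι k a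
      rw [lift_ι_apply, hf1]
    exact fun u => DFunLike.congr_fun h u
  refine ⟨(TrivSqZeroExt.sndHom _ _).restrictScalars k ∘ₗ (lift k f).toLinearMap, fun a u => ?_⟩
  change (lift k f (ι k a * u)).snd = _ + _ * (lift k f u).snd
  rw [map_mul, lift_ι_apply, TrivSqZeroExt.snd_mul, hfst, hf1, hf2]
  exact add_comm _ _

/-- A Lie algebra with an ideal `A` of codimension one acts on the enveloping algebra of `A`: the
ideal by left multiplication, and a vector `x` spanning a complement by the derivation that extends
the inner derivation of `x`. In particular an element of `A` that survives in the enveloping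
algebra of `A` survives in that of the whole Lie algebra. -/
theorem ι_ne_zero_of_mem_ideal (A : LieIdeal k L) (hA : IsCoatom A.toSubmodule)
    (hLA : ∀ x y : L, ⁅x, y⁆ ∈ A) {z : A} (hz : ι k z ≠ 0) : ι k (z : L) ≠ 0 := by
  obtain ⟨x, hx⟩ : ∃ x, x ∉ A.toSubmodule := by
    by_contra! h
    exact hA.1 (eq_top_iff.2 fun x _ => h x)
  obtain ⟨c₀, hc₀x, hc₀⟩ := Submodule.exists_le_ker_of_notMem hx
  -- The linear form with kernel `A` that takes the value `1` at `x`.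
  let c : L →ₗ[k] k := (c₀ x)⁻¹ • c₀
  have hcx : c x = 1 := by simp [c, hc₀x]
  have hker : LinearMap.ker c = A.toSubmodule := by
    refine ((hA.le_iff_eq ?_).1 fun y hy => ?_)
    · intro h
      have : x ∈ LinearMap.ker c := h ▸ Submodule.mem_top
      rw [LinearMap.mem_ker, hcx] at this
      exact one_ne_zero this
    · have : c₀ y = 0 := hc₀ hy
      simp [c, this]
  have hmem : ∀ y, c y = 0 ↔ y ∈ A := fun y => by
    rw [← LinearMap.mem_ker, hker]; rfl
  have hcl : ∀ y y', c ⁅y, y'⁆ = 0 := fun y y' => (hmem _).2 (hLA y y')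
  -- The projection onto `A` along `x`.
  let π : L →ₗ[k] A := LinearMap.codRestrict A.toSubmodule (LinearMap.id - c.smulRight x)
    fun y => by
      rw [← hker]
      simp [hcx]
  have hπ : ∀ y, (π y : L) = y - c y • x := fun y => rfl
  let δ : LieDerivation k A A :=
    LieDerivation.mk ((LieModule.toEnd k L A x : A →ₗ[k] A)) fun a b => by
      refine Subtype.ext ?_
      change ⁅x, ⁅(a : L), (b : L)⁆⁆ = ⁅(a : L), ⁅x, (b : L)⁆⁆ - ⁅(b : L), ⁅x, (a : L)⁆⁆
      rw [leibniz_lie, ← lie_skew (b : L), sub_neg_eq_add, add_comm]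
  obtain ⟨D, hD⟩ := exists_derivation_extension δ
  let ρ : L →ₗ⁅k⁆ Module.End k (UniversalEnvelopingAlgebra k A) :=
    { (LinearMap.mul k (UniversalEnvelopingAlgebra k A)) ∘ₗ (ι k : A →ₗ⁅k⁆ _).toLinearMap ∘ₗ π +
        c.smulRight D with
      map_lie' := fun {y y'} => by
        have e : π ⁅y, y'⁆ = ⁅π y, π y'⁆ + c y • δ (π y') - c y' • δ (π y) := by
          refine Subtype.ext ?_
          change (π ⁅y, y'⁆ : L) = ⁅(π y : L), (π y' : L)⁆ + c y • ⁅x, (π y' : L)⁆ -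
            c y' • ⁅x, (π y : L)⁆
          rw [hπ, hπ, hπ, hcl]
          simp only [zero_smul, sub_zero, lie_sub, sub_lie, lie_smul, smul_lie, lie_self,
            smul_zero]
          rw [← lie_skew x y, smul_neg]
          abel
        refine LinearMap.ext fun u => ?_
        rw [LieRing.of_associative_ring_bracket]
        change ι k (π ⁅y, y'⁆) * u + c ⁅y, y'⁆ • D u =
          (ι k (π y) * (ι k (π y') * u + c y' • D u) + c y • D (ι k (π y') * u + c y' • D u)) -
          (ι k (π y') * (ι k (π y) * u + c y • D u) + c y' • D (ι k (π y) * u + c y • D u))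
        rw [e, hcl]
        simp only [map_add, map_sub, map_smul, hD, LieHom.map_lie,
          LieRing.of_associative_ring_bracket, mul_add, add_mul, sub_mul, mul_smul_comm,
          smul_mul_assoc, smul_add, zero_smul, mul_assoc]
        rw [smul_comm (c y') (c y)]
        abel }
  intro h
  have h1 : ρ (z : L) = 0 := by rw [← lift_ι_apply k ρ, h, map_zero]
  have hcz : c (z : L) = 0 := (hmem _).2 z.2
  have hπz : π (z : L) = z := Subtype.ext (by rw [hπ, hcz, zero_smul, sub_zero])
  have h2 : ι k (π (z : L)) * 1 + c (z : L) • D 1 = 0 := DFunLike.congr_fun h1 1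
  rw [hπz, hcz, zero_smul, add_zero, mul_one] at h2
  exact hz h2

/-- The injectivity part of the Poincaré–Birkhoff–Witt theorem for finite-dimensional solvable Lie
algebras. The algebra has an ideal `A` of codimension one; nonzero elements of `A` are detected by
induction in the action on the enveloping algebra of `A`, the others by a linear form with kernel
`A`. -/
theorem ι_injective_of_isSolvable (k L : Type*) [Field k] [LieRing L] [LieAlgebra k L]
    [Module.Finite k L] [LieAlgebra.IsSolvable L] :
    Function.Injective (ι k : L →ₗ⁅k⁆ UniversalEnvelopingAlgebra k L) := by
  rw [injective_iff_map_eq_zero]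
  intro z
  contrapose!
  intro hz
  have : Nontrivial L := ⟨z, 0, hz⟩
  obtain H | ⟨A, hA, hAL⟩ :=
    eq_top_or_exists_le_coatom (LieAlgebra.derivedSeries k L 1).toSubmodule
  · rw [LieSubmodule.toSubmodule_eq_top] at H
    exact ((LieAlgebra.derivedSeries_lt_top_of_solvable k L).ne H).elim
  have hcomm : ∀ x y : L, ⁅x, y⁆ ∈ A := fun x y =>
    hAL (LieSubmodule.lie_mem_lie (LieSubmodule.mem_top x) (LieSubmodule.mem_top y))
  lift A to LieIdeal k L
  · exact fun _ => hcomm _ _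
  by_cases hzA : z ∈ A
  · have ih := ι_injective_of_isSolvable k A
    refine ι_ne_zero_of_mem_ideal A hA hcomm (z := ⟨z, hzA⟩) ?_
    exact fun h => hz (congrArg Subtype.val (ih (h.trans (map_zero _).symm)))
  · obtain ⟨c, hcz, hc⟩ := Submodule.exists_le_ker_of_notMem (p := A.toSubmodule) hzA
    let f : L →ₗ⁅k⁆ k :=
      { c with
        map_lie' := fun {x y} => by
          rw [LieRing.of_associative_ring_bracket, mul_comm, sub_self]
          exact hc (hcomm x y) }
    intro h
    have h2 := lift_ι_apply k f z
    rw [h, map_zero] at h2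
    exact hcz h2.symm
termination_by Module.finrank k L
decreasing_by
  rw [← finrank_top k L]
  exact Submodule.finrank_lt_finrank_of_lt hA.lt_top

end Enveloping

/-! ### The trace monoid -/

section Trace

variable {V : Type*} (Γ : SimpleGraph V)

/-- The defining relations `uv = vu`, for `u` and `v` adjacent, of the trace monoid. -/
def traceRel (x y : FreeMonoid V) : Prop :=
  ∃ u v, Γ.Adj u v ∧ x = FreeMonoid.of u * FreeMonoid.of v ∧ y = FreeMonoid.of v * FreeMonoid.of u

/-- The trace monoid (free partially commutative monoid) of `Γ`: the monoid with the generators and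
relations of the right-angled Artin group. -/
abbrev TraceMonoid : Type _ := PresentedMonoid (traceRel Γ)

namespace TraceMonoid

variable {Γ}

/-- The generator of the trace monoid attached to a vertex. -/
def of (v : V) : TraceMonoid Γ := PresentedMonoid.of (traceRel Γ) v

theorem of_mul_of_comm {u v : V} (h : Γ.Adj u v) : of (Γ := Γ) u * of v = of v * of u :=
  PresentedMonoid.mk_eq_mk_of_rel ⟨u, v, h, rfl, rfl⟩

open Classical in
/-- Deleting the first occurrence of `v` from a word is compatible with the defining relations of
the trace monoid, hence left multiplication by `v` is injective. -/
theorem of_mul_injective (v : V) : Function.Injective fun x : TraceMonoid Γ => of v * x := by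
  let e : FreeMonoid V → TraceMonoid Γ := fun x =>
    PresentedMonoid.mk (traceRel Γ) (FreeMonoid.ofList (x.toList.erase v))
  have he : ∀ x y : FreeMonoid V, e (x * y) =
      if v ∈ x.toList then e x * PresentedMonoid.mk _ y else PresentedMonoid.mk _ x * e y := by
    intro x y
    simp only [e, FreeMonoid.toList_mul, List.erase_append]
    split_ifs <;> rw [FreeMonoid.ofList_append, map_mul, FreeMonoid.ofList_toList]
  -- Whether the occurrence to delete lies in the left or the right factor of a product depends on
  -- the membership of `v`, which therefore has to be part of the congruence.
  let c : Con (FreeMonoid V) :=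
    { r := fun x y => PresentedMonoid.mk (traceRel Γ) x = PresentedMonoid.mk (traceRel Γ) y ∧
        (v ∈ x.toList ↔ v ∈ y.toList) ∧ e x = e y
      iseqv :=
        { refl := fun _ => ⟨rfl, Iff.rfl, rfl⟩
          symm := fun h => ⟨h.1.symm, h.2.1.symm, h.2.2.symm⟩
          trans := fun h h' => ⟨h.1.trans h'.1, h.2.1.trans h'.2.1, h.2.2.trans h'.2.2⟩ }
      mul' := by
        rintro w x y z ⟨h1, h2, h3⟩ ⟨h1', h2', h3'⟩
        refine ⟨by rw [map_mul, map_mul, h1, h1'], ?_, ?_⟩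
        · simp only [FreeMonoid.toList_mul, List.mem_append, h2, h2']
        · simp only [he, h1, h1', h2, h3, h3'] }
  have hc : conGen (traceRel Γ) ≤ c := by
    refine Con.conGen_le.2 ?_
    rintro _ _ ⟨a, b, hab, rfl, rfl⟩
    refine ⟨of_mul_of_comm hab, ?_, ?_⟩
    · simp only [FreeMonoid.toList_mul, List.mem_append, or_comm]
    · have hne := hab.ne
      simp only [e, FreeMonoid.toList_mul, FreeMonoid.toList_of, List.singleton_append]
      by_cases ha : a = v
      · subst ha
        simp [hne.symm]
      · by_cases hb : b = v
        · subst hb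
          simp [hne]
        · simp only [List.erase_cons, List.erase_nil, beq_iff_eq, ha, hb, if_false]
          exact of_mul_of_comm hab
  intro x y hxy
  induction x using PresentedMonoid.inductionOn with | _ x
  induction y using PresentedMonoid.inductionOn with | _ y
  have h := (hc (PresentedMonoid.mk_eq_mk_iff.1
    (hxy : PresentedMonoid.mk _ (FreeMonoid.of v * x) =
      PresentedMonoid.mk _ (FreeMonoid.of v * y)))).2.2
  simpa [e] using h

theorem of_pow_mul_injective (v : V) (k : ℕ) :
    Function.Injective fun x : TraceMonoid Γ => of v ^ k * x := by
  induction k with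
  | zero => exact fun x y h => by simpa using h
  | succ k ih =>
    intro x y h
    simp only [pow_succ, mul_assoc] at h
    exact of_mul_injective v (ih h)

open Classical in
/-- For non-adjacent `v` and `w`, the projection of the trace monoid onto the free monoid on `v` and
`w` that deletes all other letters. -/
noncomputable def proj (v w : V) (h : ¬ Γ.Adj v w) : TraceMonoid Γ →* FreeMonoid V :=
  PresentedMonoid.lift (fun u => if u = v ∨ u = w then FreeMonoid.of u else 1) <| by
    rintro _ _ ⟨a, b, hab, rfl, rfl⟩
    simp only [map_mul, FreeMonoid.lift_eval_of]
    have hne := hab.ne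
    by_cases ha : a = v ∨ a = w
    · by_cases hb : b = v ∨ b = w
      · obtain rfl | rfl := ha <;> obtain rfl | rfl := hb
        · exact (hne rfl).elim
        · exact (h hab).elim
        · exact (h hab.symm).elim
        · exact (hne rfl).elim
      · simp [hb]
    · simp [ha]

theorem proj_of_left (v w : V) (h : ¬ Γ.Adj v w) : proj v w h (of v) = FreeMonoid.of v := by
  simp [proj, of]

/-- The length of a trace. -/
def length : TraceMonoid Γ →* Multiplicative ℕ :=
  PresentedMonoid.lift (fun _ => Multiplicative.ofAdd 1) <| by
    rintro _ _ ⟨a, b, hab, rfl, rfl⟩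
    simp

theorem length_of (v : V) : length (Γ := Γ) (of v) = Multiplicative.ofAdd 1 := rfl

theorem length_mk (x : FreeMonoid V) :
    length (PresentedMonoid.mk (traceRel Γ) x) = Multiplicative.ofAdd x.length := by
  induction x with
  | one => rfl
  | of v => rfl
  | mul x y hx hy => rw [map_mul, map_mul, hx, hy, FreeMonoid.length_mul, ofAdd_add]

/-- The projection does not increase lengths, and keeps the letters `v` and `w`. -/
theorem proj_mk (v w : V) (h : ¬ Γ.Adj v w) (x : FreeMonoid V) :
    (proj v w h (PresentedMonoid.mk (traceRel Γ) x)).length ≤ x.length ∧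
    ∀ u, u = v ∨ u = w → (u ∈ (proj v w h (PresentedMonoid.mk (traceRel Γ) x)).toList ↔
      u ∈ x.toList) := by
  classical
  induction x with
  | one => exact ⟨le_rfl, fun u _ => Iff.rfl⟩
  | of a =>
    change (ite _ _ _ : FreeMonoid V).length ≤ _ ∧
      ∀ u, _ → (u ∈ (ite _ _ _ : FreeMonoid V).toList ↔ _)
    split_ifs with ha
    · simp
    · refine ⟨by simp, fun u hu => ?_⟩
      have : u ≠ a := fun e => ha (e ▸ hu)
      simp [this]
  | mul x y hx hy =>
    rw [map_mul, map_mul, FreeMonoid.length_mul, FreeMonoid.length_mul]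
    refine ⟨add_le_add hx.1 hy.1, fun u hu => ?_⟩
    rw [FreeMonoid.toList_mul, FreeMonoid.toList_mul, List.mem_append, List.mem_append,
      hx.2 u hu, hy.2 u hu]

/-- Suppose that for every vertex `v` each product `v ^ k * m` can be rewritten with `v ^ k` on the
right. If no vertex is adjacent to all others, then `m` is trivial: for each `w` there is `v` not
adjacent to `w`, and in the free monoid on `v` and `w` the rewriting forces the projection of `m` to
be a power of `v`. -/
theorem eq_one_of_pow_mul_eq (hΓ : ∀ w, ∃ v, v ≠ w ∧ ¬ Γ.Adj v w) (m : TraceMonoid Γ)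
    (hm : ∀ v k, ∃ m', of v ^ k * m = m' * of v ^ k) : m = 1 := by
  induction m using PresentedMonoid.inductionOn with | _ x
  suffices h : ∀ w, w ∉ x.toList by
    have : x.toList = [] := List.eq_nil_iff_forall_not_mem.2 h
    have : x = 1 := FreeMonoid.toList.injective this
    rw [this, map_one]
  intro w hw
  obtain ⟨v, hvw, hadj⟩ := hΓ w
  -- The exponent is the length of `m`, so that the projection of `m'` is a prefix of the power of
  -- `v` in front.
  obtain ⟨m', hm'⟩ := hm v x.length
  induction m' using PresentedMonoid.inductionOn with | _ y
  have hlen : x.length = y.length := by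
    have := congrArg (fun z => Multiplicative.toAdd (length z)) hm'
    simp only [map_mul, map_pow, length_mk, length_of, toAdd_mul, toAdd_pow, toAdd_ofAdd] at this
    omega
  have hp := congrArg (fun z => (proj v w hadj z).toList) hm'
  have hpow : ∀ k, (FreeMonoid.of v ^ k).toList = List.replicate k v := fun k => by
    induction k with
    | zero => rfl
    | succ k ih => rw [pow_succ', FreeMonoid.toList_mul, ih]; rfl
  simp only [map_mul, map_pow, proj_of_left, FreeMonoid.toList_mul, hpow] at hp
  set a := (proj v w hadj (PresentedMonoid.mk (traceRel Γ) x)).toList with ha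
  set b := (proj v w hadj (PresentedMonoid.mk (traceRel Γ) y)).toList with hb
  have hbl : b.length ≤ x.length := hlen ▸ (proj_mk v w hadj y).1
  have hwa : w ∈ a := ((proj_mk v w hadj x).2 w (Or.inr rfl)).2 hw
  have hpre : b <+: List.replicate x.length v :=
    List.prefix_of_prefix_length_le (hp ▸ List.prefix_append b _) (List.prefix_append _ a)
      (by simpa using hbl)
  have hwm : w ∈ b ++ List.replicate x.length v := hp ▸ List.mem_append_right _ hwa
  rcases List.mem_append.1 hwm with h | h
  · exact hvw (List.eq_of_mem_replicate (hpre.subset h)).symm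
  · exact hvw (List.eq_of_mem_replicate h).symm

end TraceMonoid

open TraceMonoid in
/-- If no vertex is adjacent to all others, the centre of the trace algebra over `R` consists of the
constants. -/
theorem coeff_eq_zero_of_commute_of {R : Type*} [CommRing R] {Γ : SimpleGraph V}
    (hΓ : ∀ w, ∃ v, v ≠ w ∧ ¬ Γ.Adj v w) (X : MonoidAlgebra R (TraceMonoid Γ))
    (hX : ∀ v, Commute X (MonoidAlgebra.of R _ (TraceMonoid.of v))) {m : TraceMonoid Γ}
    (hm : m ≠ 1) : X.coeff m = 0 := by
  by_contra hne
  refine hm (eq_one_of_pow_mul_eq hΓ m fun v k => ?_)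
  have hk := (hX v).pow_right k
  rw [← map_pow, MonoidAlgebra.of_apply] at hk
  have h := congrArg (fun Y : MonoidAlgebra R (TraceMonoid Γ) => Y.coeff (of v ^ k * m)) hk.eq
  rw [MonoidAlgebra.coeff_single_mul_eq_mul_coeff m
    (fun z _ => (of_pow_mul_injective v k).eq_iff), one_mul] at h
  by_contra! hcon
  rw [MonoidAlgebra.coeff_mul_single_of_forall_mul_ne _ _ fun d hd => hcon d hd.symm] at h
  exact hne h.symm

end Trace

/-! ### Leading coefficients of the lower central series in a power series ring -/

section LeadingCoeff

open PowerSeries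

variable {B : Type*} [Ring B]

/-- Lowest-order coefficients multiply, also over a noncommutative ring. -/
theorem coeff_mul_of_X_pow_dvd {i j : ℕ} {f g : B⟦X⟧} (hf : X ^ i ∣ f) (hg : X ^ j ∣ g) :
    X ^ (i + j) ∣ f * g ∧ coeff (i + j) (f * g) = coeff i f * coeff j g := by
  obtain ⟨f, rfl⟩ := hf
  obtain ⟨g, rfl⟩ := hg
  have e : X ^ i * f * (X ^ j * g) = X ^ (i + j) * (f * g) := by
    rw [pow_add, mul_assoc, mul_assoc, ← mul_assoc f, ← mul_assoc (X ^ j) f g,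
      (commute_X_pow f j).eq]
  refine ⟨⟨_, e⟩, ?_⟩
  rw [e]
  have h := fun (n : ℕ) (p : B⟦X⟧) => coeff_X_pow_mul p n 0
  simp only [zero_add] at h
  rw [h, h, h]
  simp

theorem coeff_eq_zero_of_X_pow_dvd {m n : ℕ} {f : B⟦X⟧} (hf : X ^ n ∣ f) (h : m < n) :
    coeff m f = 0 :=
  X_pow_dvd_iff.1 hf m h

variable (B) in
/-- The units of `B⟦X⟧` that are congruent to `1` modulo `X ^ n`. -/
def congruenceSubgroup (n : ℕ) : Subgroup B⟦X⟧ˣ where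
  carrier := {u | X ^ n ∣ (u : B⟦X⟧) - 1}
  one_mem' := by simp
  mul_mem' := fun {u v} (hu : _ ∣ _) (hv : _ ∣ _) => by
    have e : ((u * v : B⟦X⟧ˣ) : B⟦X⟧) - 1 = (u - 1) * v + (v - 1) := by
      rw [Units.val_mul, sub_mul, one_mul, sub_add_sub_cancel]
    rw [Set.mem_ofPred_eq, e]
    exact dvd_add (hu.mul_right _) hv
  inv_mem' := fun {u} (hu : _ ∣ _) => by
    have e : ((u⁻¹ : B⟦X⟧ˣ) : B⟦X⟧) - 1 = -((u - 1) * (u⁻¹ : B⟦X⟧ˣ)) := by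
      rw [sub_mul, Units.mul_inv, one_mul, neg_sub]
    rw [Set.mem_ofPred_eq, e]
    exact (hu.mul_right _).neg_right

theorem mem_congruenceSubgroup {n : ℕ} {u : B⟦X⟧ˣ} :
    u ∈ congruenceSubgroup B n ↔ X ^ n ∣ (u : B⟦X⟧) - 1 := Iff.rfl

theorem mem_congruenceSubgroup_one {u : B⟦X⟧ˣ} :
    u ∈ congruenceSubgroup B 1 ↔ constantCoeff (u : B⟦X⟧) = 1 := by
  rw [mem_congruenceSubgroup, pow_one, X_dvd_iff, map_sub, map_one, sub_eq_zero]

theorem constantCoeff_inv_of_mem {u : B⟦X⟧ˣ} (hu : u ∈ congruenceSubgroup B 1) :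
    constantCoeff ((u⁻¹ : B⟦X⟧ˣ) : B⟦X⟧) = 1 :=
  mem_congruenceSubgroup_one.1 (inv_mem hu)

/-- The commutator of units `1 + f` and `1 + g` with `f` and `g` of order at least `i` and `j` has
leading term the ring commutator of the leading terms of `f` and `g`. -/
theorem commutator_congruenceSubgroup {i j : ℕ} {u v : B⟦X⟧ˣ} (hu1 : u ∈ congruenceSubgroup B 1)
    (hv1 : v ∈ congruenceSubgroup B 1) (hu : u ∈ congruenceSubgroup B i)
    (hv : v ∈ congruenceSubgroup B j) :
    ⁅u, v⁆ ∈ congruenceSubgroup B (i + j) ∧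
      coeff (i + j) ((⁅u, v⁆ : B⟦X⟧ˣ) - 1 : B⟦X⟧) =
        coeff i (u - 1 : B⟦X⟧) * coeff j (v - 1 : B⟦X⟧) -
          coeff j (v - 1 : B⟦X⟧) * coeff i (u - 1 : B⟦X⟧) := by
  rw [mem_congruenceSubgroup] at hu hv ⊢
  have e : (⁅u, v⁆ : B⟦X⟧ˣ) - (1 : B⟦X⟧) =
      ((u - 1) * (v - 1) - (v - 1) * (u - 1) : B⟦X⟧) * ((u⁻¹ * v⁻¹ : B⟦X⟧ˣ) : B⟦X⟧) := by
    have h1 : ((u - 1) * (v - 1) - (v - 1) * (u - 1) : B⟦X⟧) = u * v - v * u := by noncomm_ring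
    have h2 : (v * u : B⟦X⟧) * ((u⁻¹ * v⁻¹ : B⟦X⟧ˣ) : B⟦X⟧) = 1 := by
      rw [← Units.val_mul, ← Units.val_mul, ← mul_inv_rev, mul_inv_cancel, Units.val_one]
    rw [h1, sub_mul, h2, commutatorElement_def, mul_assoc (u * v), Units.val_mul, Units.val_mul u]
  have hA := coeff_mul_of_X_pow_dvd hu hv
  have hB := coeff_mul_of_X_pow_dvd hv hu
  rw [add_comm j i] at hB
  have hc : constantCoeff ((u⁻¹ * v⁻¹ : B⟦X⟧ˣ) : B⟦X⟧) = 1 := by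
    rw [Units.val_mul, map_mul, constantCoeff_inv_of_mem hu1, constantCoeff_inv_of_mem hv1, mul_one]
  have hd := dvd_sub hA.1 hB.1
  refine ⟨e ▸ hd.mul_right _, ?_⟩
  have := (coeff_mul_of_X_pow_dvd (j := 0) (g := ((u⁻¹ * v⁻¹ : B⟦X⟧ˣ) : B⟦X⟧)) hd (by simp)).2
  rw [add_zero, coeff_zero_eq_constantCoeff_apply, hc, mul_one] at this
  rw [e, this, map_sub, hA.2, hB.2]

variable {G : Type*} [Group G] {μ : G →* B⟦X⟧ˣ}

theorem map_lcs_mem_congruenceSubgroup (hμ : ∀ g, μ g ∈ congruenceSubgroup B 1) (c : ℕ+) {g : G}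
    (hg : g ∈ lcs G c) : μ g ∈ congruenceSubgroup B c := by
  suffices h : lcs G c ≤ (congruenceSubgroup B c).comap μ from h hg
  clear hg
  induction c using PNat.recOn with
  | one => exact fun g _ => hμ g
  | succ c ih =>
    rw [lcs_add_one, Subgroup.commutator_le]
    intro x hx y _
    rw [Subgroup.mem_comap, map_commutatorElement]
    exact (commutator_congruenceSubgroup (hμ x) (hμ y) (ih hx) (hμ y)).1

/-- The homomorphism on `γ_c` that sends `g` to the coefficient of `X ^ c` in `μ g`. -/
noncomputable def lcsCoeff (hμ : ∀ g, μ g ∈ congruenceSubgroup B 1) (c : ℕ+) :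
    lcs G c →* Multiplicative B where
  toFun g := Multiplicative.ofAdd (coeff c ((μ g : B⟦X⟧) - 1))
  map_one' := by simp
  map_mul' x y := by
    have e : ((μ (x * y : lcs G c) : B⟦X⟧ˣ) : B⟦X⟧) - 1 =
        ((μ x : B⟦X⟧) - 1) * ((μ y : B⟦X⟧) - 1) + ((μ x : B⟦X⟧) - 1) + ((μ y : B⟦X⟧) - 1) := by
      rw [Subgroup.coe_mul, map_mul, Units.val_mul]
      noncomm_ring
    have h := (coeff_mul_of_X_pow_dvd (map_lcs_mem_congruenceSubgroup hμ c x.2)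
      (map_lcs_mem_congruenceSubgroup hμ c y.2)).1
    have h0 := coeff_eq_zero_of_X_pow_dvd h (Nat.lt_add_of_pos_right c.pos)
    rw [e, ← ofAdd_add, map_add (coeff _), map_add (coeff _), h0, zero_add]

/-- The map `L_c → B` that sends the class of `g` to the coefficient of `X ^ c` in `μ g`. -/
noncomputable def leadingCoeff (hμ : ∀ g, μ g ∈ congruenceSubgroup B 1) (c : ℕ+) :
    LcsQuot G c →+ B :=
  MonoidHom.toAdditiveLeft <|
    QuotientGroup.lift ((lcs G (c + 1)).subgroupOf (lcs G c)) (lcsCoeff hμ c) fun g hg =>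
      congrArg Multiplicative.ofAdd (coeff_eq_zero_of_X_pow_dvd
        (map_lcs_mem_congruenceSubgroup hμ (c + 1) (Subgroup.mem_subgroupOf.1 hg)) (by simp))

theorem leadingCoeff_mk (hμ : ∀ g, μ g ∈ congruenceSubgroup B 1) {c : ℕ+} (g : lcs G c) :
    leadingCoeff hμ c (LcsQuot.mk g) = coeff c ((μ g : B⟦X⟧) - 1) := rfl

/-- The Lie ring homomorphism from the associated graded Lie ring of `G` to the ring `B` that is
induced by a homomorphism from `G` to the units of `B⟦X⟧` with constant term `1`. -/
noncomputable def gradedHom (hμ : ∀ g, μ g ∈ congruenceSubgroup B 1) : LcsLie G →ₗ⁅ℤ⁆ B :=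
  { (LcsLie.lift (leadingCoeff hμ)).toIntLinearMap with
    map_lie' := fun {x y} => by
      change LcsLie.lift (leadingCoeff hμ) ⁅x, y⁆ =
        ⁅LcsLie.lift (leadingCoeff hμ) x, LcsLie.lift (leadingCoeff hμ) y⁆
      induction x using LcsLie.induction with
      | zero => simp
      | add x x' hx hx' => rw [add_lie, map_add, map_add, add_lie, hx, hx']
      | of i a =>
        induction y using LcsLie.induction with
        | zero => simp
        | add y y' hy hy' => rw [lie_add, map_add, map_add, lie_add, hy, hy']
        | of j b =>
          obtain ⟨x, rfl⟩ := LcsQuot.mk_surjective a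
          obtain ⟨y, rfl⟩ := LcsQuot.mk_surjective b
          rw [LcsLie.lie_of_mk_of_mk, LcsLie.lift_of, LcsLie.lift_of, LcsLie.lift_of,
            leadingCoeff_mk, leadingCoeff_mk, leadingCoeff_mk, LieRing.of_associative_ring_bracket,
            map_commutatorElement, PNat.add_coe]
          exact (commutator_congruenceSubgroup (hμ x) (hμ y)
            (map_lcs_mem_congruenceSubgroup hμ i x.2) (map_lcs_mem_congruenceSubgroup hμ j y.2)).2 }

theorem gradedHom_of_mk (hμ : ∀ g, μ g ∈ congruenceSubgroup B 1) {c : ℕ+} (g : lcs G c) :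
    gradedHom hμ (LcsLie.of c (LcsQuot.mk g)) = coeff c ((μ g : B⟦X⟧) - 1) :=
  LcsLie.lift_of _ c _

/-- The unit `1 + b X` of `B⟦X⟧`. -/
noncomputable def oneAddMulX (b : B) : B⟦X⟧ˣ where
  val := 1 + C b * X
  inv := PowerSeries.mk fun n => (-b) ^ n
  val_inv := by
    ext n
    rw [add_mul, one_mul, mul_assoc, map_add, coeff_C_mul]
    cases n with
    | zero => simp
    | succ n => simp [coeff_succ_X_mul, pow_succ', coeff_one]
  inv_val := by
    ext n
    rw [mul_add, mul_one, ← mul_assoc, map_add]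
    cases n with
    | zero => simp
    | succ n => simp [coeff_succ_mul_X, pow_succ, coeff_one]

theorem oneAddMulX_commute {a b : B} (h : Commute a b) : Commute (oneAddMulX a) (oneAddMulX b) := by
  have hX : ∀ f : B⟦X⟧, Commute X f := fun f => (commute_X f).symm
  have hC : Commute (C a * X : B⟦X⟧) (C b * X) :=
    ((h.map C).mul_right (hX _).symm).mul_left ((hX _).mul_right (hX _))
  refine Units.ext ?_
  exact ((Commute.one_left _).add_left ((Commute.one_right _).add_right hC)).eq

end LeadingCoeff

/-! ### Generation of the associated graded Lie ring, and its truncations -/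

namespace LcsLie

section General

variable {G : Type*} [Group G]

theorem of_mem_degreePart {c : ℕ+} (a : LcsQuot G c) : of c a ∈ degreePart G c := ⟨a, rfl⟩

/-- The class in `L_1` of an element of the group. -/
def deg1 (g : G) : LcsLie G := of 1 (LcsQuot.mk ⟨g, Subgroup.mem_top g⟩)

theorem deg1_lie_deg1_of_commute {g h : G} (hgh : Commute g h) : ⁅deg1 g, deg1 h⁆ = 0 := by
  rw [deg1, deg1, lie_of_mk_of_mk]
  refine (congrArg (of (1 + 1)) ?_).trans (map_zero _)
  refine Eq.trans ?_ LcsQuot.mk_one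
  exact congrArg LcsQuot.mk (Subtype.ext (commutatorElement_eq_one_iff_commute.2 hgh))

/-- To contain `L_1` it suffices to contain the classes of a generating set of the group. -/
theorem degreePart_one_le {S : Set G} (hS : Subgroup.closure S = ⊤) {P : Submodule ℤ (LcsLie G)}
    (hP : ∀ g ∈ S, deg1 g ∈ P) : degreePart G 1 ≤ P := by
  rintro _ ⟨a, rfl⟩
  obtain ⟨⟨x, hx⟩, rfl⟩ := LcsQuot.mk_surjective a
  change deg1 x ∈ P
  have hx' : x ∈ Subgroup.closure S := hS ▸ Subgroup.mem_top x
  induction hx' using Subgroup.closure_induction with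
  | mem x hxS => exact hP x hxS
  | one =>
    have : deg1 (1 : G) = 0 := map_zero (of (G := G) 1)
    exact this ▸ P.zero_mem
  | mul x y _ _ ihx ihy =>
    have := P.add_mem (ihx (Subgroup.mem_top x)) (ihy (Subgroup.mem_top y))
    rwa [deg1, deg1, ← map_add, ← LcsQuot.mk_mul] at this
  | inv x _ ih =>
    have := P.neg_mem (ih (Subgroup.mem_top x))
    rwa [deg1, ← map_neg] at this

/-- `L_{c+1}` is spanned by the brackets of `L_c` with `L_1`. -/
theorem degreePart_add_one_le {c : ℕ+} {P : Submodule ℤ (LcsLie G)}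
    (hP : ∀ x ∈ degreePart G c, ∀ y ∈ degreePart G 1, ⁅x, y⁆ ∈ P) : degreePart G (c + 1) ≤ P := by
  rintro _ ⟨a, rfl⟩
  obtain ⟨⟨x, hx⟩, rfl⟩ := LcsQuot.mk_surjective a
  change of (c + 1) (LcsQuot.mk ⟨x, hx⟩) ∈ P
  suffices h : ∃ h : x ∈ lcs G (c + 1), of (c + 1) (LcsQuot.mk ⟨x, h⟩) ∈ P from h.2
  have hx' := hx
  rw [lcs_add_one, Subgroup.commutator_def] at hx'
  clear hx
  induction hx' using Subgroup.closure_induction with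
  | mem x hx =>
    obtain ⟨y, hy, z, hz, rfl⟩ := hx
    have h := hP _ (of_mem_degreePart (LcsQuot.mk ⟨y, hy⟩)) _
      (of_mem_degreePart (LcsQuot.mk (c := 1) ⟨z, hz⟩))
    rw [lie_of_mk_of_mk] at h
    exact ⟨_, h⟩
  | one => exact ⟨one_mem _, (map_zero (of (G := G) (c + 1))).symm ▸ P.zero_mem⟩
  | mul x y _ _ ihx ihy =>
    obtain ⟨hx, ihx⟩ := ihx
    obtain ⟨hy, ihy⟩ := ihy
    have := P.add_mem ihx ihy
    rw [← map_add, ← LcsQuot.mk_mul] at this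
    exact ⟨mul_mem hx hy, this⟩
  | inv x _ ih =>
    obtain ⟨hx, ih⟩ := ih
    have := P.neg_mem ih
    rw [← map_neg] at this
    exact ⟨inv_mem hx, this⟩

/-- As `L` is generated by `L_1`, a homomorphism from `L` is determined by its values on the classes
of generators of the group. -/
theorem lieHom_ext_of_closure {S : Set G} (hS : Subgroup.closure S = ⊤) {A : Type*} [LieRing A]
    {f g : LcsLie G →ₗ⁅ℤ⁆ A} (h : ∀ s ∈ S, f (deg1 s) = g (deg1 s)) (x : LcsLie G) :
    f x = g x := by
  let P : Submodule ℤ (LcsLie G) := LinearMap.eqLocus (f : LcsLie G →ₗ[ℤ] A) (g : LcsLie G →ₗ[ℤ] A)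
  have h1 : degreePart G 1 ≤ P := degreePart_one_le hS h
  have hc : ∀ c, degreePart G c ≤ P := fun c => by
    induction c using PNat.recOn with
    | one => exact h1
    | succ c ih =>
      refine degreePart_add_one_le fun x hx y hy => ?_
      have hx' : f x = g x := ih hx
      have hy' : f y = g y := h1 hy
      change f ⁅x, y⁆ = g ⁅x, y⁆
      rw [LieHom.map_lie, LieHom.map_lie, hx', hy']
  induction x using LcsLie.induction with
  | zero => rw [map_zero, map_zero]
  | add x y hx hy => rw [map_add, map_add, hx, hy]
  | of c a => exact hc c (of_mem_degreePart a)

theorem degreePart_fg {S : Set G} (hfin : S.Finite) (hS : Subgroup.closure S = ⊤) (c : ℕ+) :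
    (degreePart G c).FG := by
  have h1 : (degreePart G 1).FG :=
    (Submodule.fg_span (hfin.image deg1)).of_le (degreePart_one_le hS fun g hg =>
      Submodule.subset_span (Set.mem_image_of_mem _ hg))
  induction c using PNat.recOn with
  | one => exact h1
  | succ c ih =>
    exact (ih.map₂ (LieModule.toEnd ℤ (LcsLie G) (LcsLie G)).toLinearMap h1).of_le
      (degreePart_add_one_le fun x hx y hy => Submodule.apply_mem_map₂ _ hx hy)

variable (G) in
/-- The projection of `L` to `L_c`. -/
def component (c : ℕ+) : LcsLie G →+ LcsQuot G c := DFinsupp.evalAddMonoidHom c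

theorem component_of_same (c : ℕ+) (a : LcsQuot G c) : component G c (of c a) = a :=
  DirectSum.of_eq_same c a

theorem component_of_ne {c d : ℕ+} (h : d ≠ c) (a : LcsQuot G d) :
    component G c (of d a) = 0 :=
  DirectSum.of_eq_of_ne d c a h.symm

theorem component_eq_zero_of_mem_tail {c d : ℕ+} (h : d ≤ c) {x : LcsLie G} (hx : x ∈ tail G c) :
    component G d x = 0 := by
  suffices hle : tailSubmodule G c ≤ LinearMap.ker (component G d).toIntLinearMap from hle hx
  refine iSup₂_le fun i hi => ?_
  rintro _ ⟨a, rfl⟩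
  exact component_of_ne (h.trans_lt hi).ne' a

/-- An element belongs to a subgroup of `L` as soon as its homogeneous components do. -/
theorem mem_of_of_component_mem {P : AddSubgroup (LcsLie G)} {x : LcsLie G}
    (h : ∀ c, of c (component G c x) ∈ P) : x ∈ P := by
  classical
  have := DirectSum.sum_support_of (β := LcsQuot G) x
  rw [← this]
  exact sum_mem fun c _ => h c

theorem lie_mem_of_mem_iSup {s : Set ℕ+} {P : Submodule ℤ (LcsLie G)}
    (hP : ∀ i, ∀ j ∈ s, degreePart G (i + j) ≤ P) (x : LcsLie G) {m : LcsLie G}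
    (hm : m ∈ ⨆ j ∈ s, degreePart G j) : ⁅x, m⁆ ∈ P := by
  suffices h : (⨆ j ∈ s, degreePart G j) ≤
      P.comap (LieModule.toEnd ℤ (LcsLie G) (LcsLie G) x) from h hm
  refine iSup₂_le fun j hj => ?_
  rintro _ ⟨b, rfl⟩
  change ⁅x, of j b⁆ ∈ P
  induction x using LcsLie.induction with
  | zero => rw [zero_lie]; exact P.zero_mem
  | add x y hx hy => rw [add_lie]; exact P.add_mem hx hy
  | of i a => rw [lie_of_of]; exact hP i j hj (of_mem_degreePart _)

theorem degreePart_le_tailSubmodule {c i : ℕ+} (h : c < i) :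
    degreePart G i ≤ tailSubmodule G c :=
  le_iSup₂_of_le (f := fun i (_ : i > c) => degreePart G i) i h le_rfl

variable (G) in
theorem iSup_degreePart : ⨆ c ∈ (Set.univ : Set ℕ+), degreePart G c = ⊤ := by
  refine eq_top_iff.2 fun x _ => ?_
  induction x using LcsLie.induction with
  | zero => exact Submodule.zero_mem _
  | add x y hx hy => exact Submodule.add_mem _ (hx Submodule.mem_top) (hy Submodule.mem_top)
  | of c a =>
    exact le_iSup₂_of_le (f := fun i (_ : i ∈ Set.univ) => degreePart G i) c (Set.mem_univ c)
      le_rfl (of_mem_degreePart a)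

/-- The bracket with `L` raises degrees, so the `c`-th derived ideal of `L` lives in degrees greater
than `c`. -/
theorem derivedSeries_le_tail (c : ℕ+) : LieAlgebra.derivedSeries ℤ (LcsLie G) c ≤ tail G c := by
  induction c using PNat.recOn with
  | one =>
    refine (LieSubmodule.lie_le_iff _ _ _).2 fun x _ m _ => ?_
    refine lie_mem_of_mem_iSup (s := Set.univ) (P := tailSubmodule G 1)
      (fun i j _ => degreePart_le_tailSubmodule ?_) x (iSup_degreePart G ▸ Submodule.mem_top)
    exact one_le.trans_lt (PNat.lt_add_right i j)
  | succ c ih =>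
    rw [PNat.add_coe, PNat.one_coe, LieAlgebra.derivedSeries,
      LieAlgebra.derivedSeriesOfIdeal_succ]
    refine (LieSubmodule.lie_le_iff _ _ _).2 fun x _ m hm => ?_
    refine lie_mem_of_mem_iSup (s := Set.Ioi c) (P := tailSubmodule G (c + 1))
      (fun i j hj => degreePart_le_tailSubmodule ?_) x (ih hm)
    rw [add_comm]
    exact add_lt_add_of_le_of_lt one_le hj

variable (G) in
/-- The quotient map `L → L^c` as a homomorphism of Lie rings. -/
def toTruncationHom (c : ℕ+) : LcsLie G →ₗ⁅ℤ⁆ Truncation G c :=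
  { toTruncation G c with
    map_lie' := fun {x y} => LieSubmodule.Quotient.mk_bracket (tail G c) x y }

theorem toTruncationHom_surjective (c : ℕ+) : Function.Surjective (toTruncationHom G c) :=
  LieSubmodule.Quotient.surjective_mk' (tail G c)

theorem toTruncationHom_eq_zero {c : ℕ+} {x : LcsLie G} :
    toTruncationHom G c x = 0 ↔ x ∈ tail G c :=
  LieSubmodule.Quotient.mk_eq_zero (tail G c)

instance (c : ℕ+) : LieAlgebra.IsSolvable (Truncation G c) := by
  refine LieAlgebra.IsSolvable.mk (R := ℤ) (k := c) ?_
  rw [← LieIdeal.derivedSeries_map_eq c (toTruncationHom_surjective c), LieIdeal.map_eq_bot_iff]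
  exact fun x hx => LieHom.mem_ker.2 (toTruncationHom_eq_zero.2 (derivedSeries_le_tail c hx))

/-- Divisibility by `n` in `L` can be tested in the truncations `L^c`. -/
theorem exists_eq_smul_of_truncation {n : ℤ} {x : LcsLie G}
    (h : ∀ c, ∃ y, toTruncationHom G c x = n • y) : ∃ y, x = n • y := by
  suffices hx : x ∈ (zsmulAddGroupHom n : LcsLie G →+ LcsLie G).range by
    obtain ⟨y, hy⟩ := hx
    exact ⟨y, hy.symm⟩
  refine mem_of_of_component_mem fun c => ?_
  obtain ⟨z, hz⟩ := h c
  obtain ⟨y, rfl⟩ := toTruncationHom_surjective c z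
  rw [← map_zsmul, ← sub_eq_zero, ← map_sub, toTruncationHom_eq_zero] at hz
  have := component_eq_zero_of_mem_tail le_rfl hz
  rw [map_sub, map_zsmul, sub_eq_zero] at this
  rw [this, map_zsmul]
  exact ⟨_, rfl⟩

theorem finite_truncation {S : Set G} (hfin : S.Finite) (hS : Subgroup.closure S = ⊤) (c : ℕ+) :
    Module.Finite ℤ (Truncation G c) := by
  have hfg : (⨆ i ∈ Finset.Iic c, degreePart G i).FG :=
    Submodule.fg_biSup _ _ fun i _ => degreePart_fg hfin hS i
  refine ⟨?_⟩
  convert hfg.map (toTruncation G c)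
  refine (eq_top_iff.2 fun z _ => ?_).symm
  obtain ⟨x, rfl⟩ := toTruncationHom_surjective c z
  induction x using LcsLie.induction with
  | zero => rw [map_zero]; exact Submodule.zero_mem _
  | add x y hx hy =>
    rw [map_add]
    exact Submodule.add_mem _ (hx Submodule.mem_top) (hy Submodule.mem_top)
  | of i a =>
    by_cases hi : i ≤ c
    · exact Submodule.mem_map_of_mem (f := toTruncation G c) (le_iSup₂_of_le
        (f := fun i (_ : i ∈ Finset.Iic c) => degreePart G i) i (Finset.mem_Iic.2 hi)
        le_rfl (of_mem_degreePart a))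
    · have : of i a ∈ tail G c :=
        degreePart_le_tailSubmodule (not_le.1 hi) (of_mem_degreePart a)
      rw [toTruncationHom_eq_zero.2 this]
      exact Submodule.zero_mem _

end General

end LcsLie

/-! ### Reduction modulo an integer -/

section Reduction

theorem map_eq_zero_of_one_tmul_eq_zero {N Q : Type*} [AddCommGroup N] [AddCommGroup Q] {n : ℕ}
    [Module (ZMod n) Q] (g : N →ₗ[ℤ] Q) {x : N} (h : (1 : ZMod n) ⊗ₜ[ℤ] x = 0) : g x = 0 := by
  have h2 : LinearMap.liftBaseChange (ZMod n) g ((1 : ZMod n) ⊗ₜ[ℤ] x) = 0 := by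
    rw [h, map_zero]
  rwa [LinearMap.liftBaseChange_tmul, one_smul] at h2

/-- The kernel of `N → ℤ/n ⊗ N` is `nN`. -/
theorem exists_eq_smul_of_one_tmul_eq_zero {N : Type*} [AddCommGroup N] {n : ℕ} {x : N}
    (h : (1 : ZMod n) ⊗ₜ[ℤ] x = 0) : ∃ y, x = (n : ℤ) • y := by
  let P : Submodule ℤ N := LinearMap.range (LinearMap.lsmul ℤ N (n : ℤ))
  have hP : ∀ z : N ⧸ P, n • z = 0 := fun z => by
    obtain ⟨z, rfl⟩ := P.mkQ_surjective z
    rw [← map_nsmul, ← Nat.cast_smul_eq_nsmul ℤ n z]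
    exact (Submodule.Quotient.mk_eq_zero P).2 ⟨z, rfl⟩
  let _ : Module (ZMod n) (N ⧸ P) := AddCommGroup.zmodModule hP
  have h2 : P.mkQ x = 0 := map_eq_zero_of_one_tmul_eq_zero P.mkQ h
  obtain ⟨y, hy⟩ := (Submodule.Quotient.mk_eq_zero P).1 h2
  exact ⟨y, hy.symm⟩

theorem exists_one_tmul_eq {N : Type*} [AddCommGroup N] {n : ℕ} (z : ZMod n ⊗[ℤ] N) :
    ∃ x : N, z = (1 : ZMod n) ⊗ₜ[ℤ] x := by
  induction z using TensorProduct.induction_on with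
  | zero => exact ⟨0, (TensorProduct.tmul_zero _ _).symm⟩
  | tmul a x =>
    obtain ⟨k, rfl⟩ := ZMod.intCast_surjective a
    refine ⟨k • x, ?_⟩
    rw [← TensorProduct.smul_tmul, zsmul_one]
  | add z w hz hw =>
    obtain ⟨x, rfl⟩ := hz
    obtain ⟨y, rfl⟩ := hw
    exact ⟨x + y, (TensorProduct.tmul_add _ _ _).symm⟩

/-- A finitely generated abelian group that is divisible by all primes is zero. -/
theorem eq_zero_of_forall_prime_divisible {K : Type*} [AddCommGroup K] [Module.Finite ℤ K]
    (hK : ∀ q : ℕ, q.Prime → ∀ x : K, ∃ y, x = (q : ℤ) • y) (x : K) : x = 0 := by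
  have hdiv : ∀ n : ℕ, n ≠ 0 → ∀ x : K, ∃ y, x = (n : ℤ) • y := by
    intro n
    induction n using Nat.recOnMul with
    | zero => exact fun h => (h rfl).elim
    | one => exact fun _ x => ⟨x, by simp⟩
    | prime q hq => exact fun _ => hK q hq
    | mul a b ha hb =>
      intro hab x
      obtain ⟨y, rfl⟩ := ha (left_ne_zero_of_mul hab) x
      obtain ⟨z, rfl⟩ := hb (right_ne_zero_of_mul hab) y
      exact ⟨z, by rw [smul_smul, Nat.cast_mul]⟩
  -- Since `2 K = K`, Nakayama's lemma gives an odd, hence nonzero, integer `r` with `r K = 0`.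
  obtain ⟨r, hr, hr0⟩ := Submodule.exists_sub_one_mem_and_smul_eq_zero_of_fg_of_le_smul
    (Ideal.span {(2 : ℤ)}) (⊤ : Submodule ℤ K) Module.Finite.fg_top fun x _ => by
      obtain ⟨y, rfl⟩ := hK 2 Nat.prime_two x
      exact Submodule.smul_mem_smul (Ideal.mem_span_singleton_self _) Submodule.mem_top
  rw [Ideal.mem_span_singleton] at hr
  obtain ⟨y, rfl⟩ := hdiv r.natAbs (by omega) x
  rcases Int.natAbs_eq r with h | h
  · rw [← h]; exact hr0 y Submodule.mem_top
  · have := hr0 y Submodule.mem_top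
    rw [h, neg_smul, neg_eq_zero] at this
    exact this

end Reduction

/-! ### The Magnus homomorphism of a right-angled Artin group -/

namespace RAAG

variable {V : Type*} {Γ : SimpleGraph V}

/-- The generator of `A_Γ` attached to a vertex. -/
def of (v : V) : RAAG Γ := PresentedGroup.of v

theorem closure_range_of : Subgroup.closure (Set.range (of (Γ := Γ))) = ⊤ :=
  PresentedGroup.closure_range_of _

theorem of_commute {u v : V} (h : Γ.Adj u v) : Commute (of (Γ := Γ) u) (of v) := by
  refine commutatorElement_eq_one_iff_commute.1 ?_
  exact PresentedGroup.one_of_mem ⟨u, v, h, rfl⟩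

/-- The homomorphism from `A_Γ` with prescribed values on the generators. -/
def lift {H : Type*} [Group H] (f : V → H) (hf : ∀ u v, Γ.Adj u v → Commute (f u) (f v)) :
    RAAG Γ →* H :=
  PresentedGroup.toGroup (f := f) <| by
    rintro _ ⟨u, v, h, rfl⟩
    rw [map_commutatorElement, FreeGroup.lift_apply_of, FreeGroup.lift_apply_of]
    exact commutatorElement_eq_one_iff_commute.2 (hf u v h)

theorem lift_of {H : Type*} [Group H] (f : V → H) (hf : ∀ u v, Γ.Adj u v → Commute (f u) (f v))
    (v : V) : lift f hf (of v) = f v :=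
  PresentedGroup.toGroup.of _

/-- If `A_Γ` has trivial centre, then no vertex is adjacent to all others. -/
theorem exists_not_adj_of_center_eq_bot (hZ : Subgroup.center (RAAG Γ) = ⊥) (w : V) :
    ∃ v, v ≠ w ∧ ¬ Γ.Adj v w := by
  by_contra! h
  have hw : of (Γ := Γ) w ∈ Subgroup.center (RAAG Γ) := by
    have : Subgroup.closure (Set.range (of (Γ := Γ))) ≤ Subgroup.centralizer {of w} := by
      rw [Subgroup.closure_le]
      rintro _ ⟨v, rfl⟩
      refine Subgroup.mem_centralizer_singleton_iff.2 ?_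
      by_cases hv : v = w
      · rw [hv]
      · exact (of_commute (h v hv)).eq
    rw [closure_range_of] at this
    exact Subgroup.mem_center_iff.2 fun g =>
      Subgroup.mem_centralizer_singleton_iff.1 (this (Subgroup.mem_top g))
  rw [hZ, Subgroup.mem_bot] at hw
  let φ : RAAG Γ →* Multiplicative ℤ :=
    lift (fun _ => Multiplicative.ofAdd (1 : ℤ)) fun _ _ _ => Commute.all _ _
  have : Multiplicative.ofAdd (1 : ℤ) = 1 := by
    rw [← map_one φ, ← hw]
    exact (lift_of (Γ := Γ) (fun _ => Multiplicative.ofAdd (1 : ℤ)) (fun _ _ _ => Commute.all _ _)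
      w).symm
  exact one_ne_zero (α := ℤ) (congrArg Multiplicative.toAdd this)

variable (Γ)

/-- The integral trace algebra of `Γ`. -/
abbrev TraceAlgebra : Type _ := MonoidAlgebra ℤ (TraceMonoid Γ)

variable {Γ}

/-- The generator of the trace algebra attached to a vertex. -/
noncomputable def letter (v : V) : TraceAlgebra Γ := MonoidAlgebra.of ℤ _ (TraceMonoid.of v)

theorem letter_commute {u v : V} (h : Γ.Adj u v) : Commute (letter (Γ := Γ) u) (letter v) :=
  Commute.map (TraceMonoid.of_mul_of_comm h) (MonoidAlgebra.of ℤ (TraceMonoid Γ))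

variable (Γ) in
/-- The Magnus homomorphism, which sends the generator `v` to `1 + v X`. -/
noncomputable def magnus : RAAG Γ →* (PowerSeries (TraceAlgebra Γ))ˣ :=
  lift (fun v => oneAddMulX (letter v)) fun _ _ h => oneAddMulX_commute (letter_commute h)

theorem magnus_mem (g : RAAG Γ) : magnus Γ g ∈ congruenceSubgroup (TraceAlgebra Γ) 1 := by
  suffices h : Subgroup.closure (Set.range (of (Γ := Γ))) ≤
      (congruenceSubgroup (TraceAlgebra Γ) 1).comap (magnus Γ) from
    h (closure_range_of (Γ := Γ) ▸ Subgroup.mem_top g)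
  rw [Subgroup.closure_le]
  rintro _ ⟨v, rfl⟩
  change magnus Γ (of v) ∈ congruenceSubgroup (TraceAlgebra Γ) 1
  rw [magnus, lift_of, mem_congruenceSubgroup_one]
  simp [oneAddMulX]

variable (Γ) in
/-- The homomorphism of Lie rings from `L` to the trace algebra given by the leading terms of the
Magnus homomorphism. -/
noncomputable def magnusLie : LcsLie (RAAG Γ) →ₗ⁅ℤ⁆ TraceAlgebra Γ := gradedHom magnus_mem

theorem magnusLie_deg1_of (v : V) : magnusLie Γ (LcsLie.deg1 (of v)) = letter v := by
  rw [magnusLie, LcsLie.deg1, gradedHom_of_mk, magnus, lift_of]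
  simp [oneAddMulX]

/-- The image of `L` in the trace algebra lies in the augmentation ideal. -/
theorem coeff_one_magnusLie (x : LcsLie (RAAG Γ)) : (magnusLie Γ x).coeff 1 = 0 := by
  -- The augmentation sends every vertex to `0`; it is the coefficient at `1`.
  let ε₀ : TraceMonoid Γ →* ℤ :=
    { toFun := fun m => 0 ^ (Multiplicative.toAdd (TraceMonoid.length m))
      map_one' := by simp
      map_mul' := fun a b => by rw [map_mul, toAdd_mul, pow_add] }
  have hε₀ : ∀ m, m ≠ 1 → ε₀ m = 0 := fun m hm => by
    induction m using PresentedMonoid.inductionOn with | _ y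
    refine zero_pow fun h => hm ?_
    rw [TraceMonoid.length_mk, toAdd_ofAdd, FreeMonoid.length_eq_zero] at h
    rw [h, map_one]
  let ε : TraceAlgebra Γ →ₐ[ℤ] ℤ := MonoidAlgebra.lift ℤ ℤ _ ε₀
  have hε : ∀ X : TraceAlgebra Γ, ε X = X.coeff 1 := fun X => by
    rw [MonoidAlgebra.lift_apply]
    refine (Finsupp.sum_eq_single 1 (fun m _ hm => ?_) fun _ => ?_).trans ?_
    · rw [hε₀ m hm, smul_zero]
    · rw [zero_smul]
    · rw [map_one ε₀, smul_eq_mul, mul_one]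
  rw [← hε]
  refine LcsLie.lieHom_ext_of_closure closure_range_of
    (f := (ε : TraceAlgebra Γ →ₗ⁅ℤ⁆ ℤ).comp (magnusLie Γ)) (g := 0) ?_ x
  rintro _ ⟨v, rfl⟩
  change ε (magnusLie Γ (LcsLie.deg1 (of v))) = 0
  rw [magnusLie_deg1_of, letter]
  change MonoidAlgebra.lift ℤ ℤ _ ε₀ (MonoidAlgebra.of ℤ _ _) = 0
  rw [MonoidAlgebra.lift_of]
  rfl

/-- Purity at a prime: an element of `L` whose image in the trace algebra is divisible by `q` is
divisible by `q`. For each `c` the composite of `L → 𝔽_q ⊗ L^c` with the embedding of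
`𝔽_q ⊗ L^c` into its enveloping algebra factors through `L → ℤ[M]`, as both maps agree on the
generators. -/
theorem exists_eq_prime_smul [Finite V] {q : ℕ} (hq : q.Prime) {x : LcsLie (RAAG Γ)}
    {Y : TraceAlgebra Γ} (h : magnusLie Γ x = (q : ℤ) • Y) : ∃ y, x = (q : ℤ) • y := by
  have : Fact q.Prime := ⟨hq⟩
  have key : ∀ c : ℕ+, ∃ y, LcsLie.toTruncationHom (RAAG Γ) c x = (q : ℤ) • y := by
    intro c
    have hfin : Module.Finite ℤ (LcsLie.Truncation (RAAG Γ) c) :=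
      LcsLie.finite_truncation (Set.finite_range of) closure_range_of c
    let K := ZMod q ⊗[ℤ] LcsLie.Truncation (RAAG Γ) c
    let U := UniversalEnvelopingAlgebra (ZMod q) K
    let f : LcsLie (RAAG Γ) →ₗ⁅ℤ⁆ U :=
      { toFun := fun x => UniversalEnvelopingAlgebra.ι (ZMod q)
          ((1 : ZMod q) ⊗ₜ[ℤ] LcsLie.toTruncationHom (RAAG Γ) c x)
        map_add' := fun x y => by rw [map_add, TensorProduct.tmul_add, map_add]
        map_smul' := fun n x => by
          rw [map_zsmul, TensorProduct.tmul_smul, map_zsmul]; rfl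
        map_lie' := fun {x y} => by
          rw [LieHom.map_lie (LcsLie.toTruncationHom (RAAG Γ) c),
            ← LieHom.map_lie (UniversalEnvelopingAlgebra.ι (ZMod q)),
            LieAlgebra.ExtendScalars.bracket_tmul, mul_one] }
    let ψ₀ : TraceMonoid Γ →* U := PresentedMonoid.lift (fun v => f (LcsLie.deg1 (of v))) <| by
      rintro _ _ ⟨u, v, huv, rfl, rfl⟩
      rw [map_mul, map_mul, FreeMonoid.lift_eval_of, FreeMonoid.lift_eval_of, ← sub_eq_zero,
        ← LieRing.of_associative_ring_bracket, ← LieHom.map_lie, LcsLie.deg1_lie_deg1_of_commute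
          (of_commute huv), map_zero]
    let ψ : TraceAlgebra Γ →ₐ[ℤ] U := MonoidAlgebra.lift ℤ U _ ψ₀
    have hf : ∀ x, f x = ψ (magnusLie Γ x) := by
      refine LcsLie.lieHom_ext_of_closure closure_range_of
        (g := (ψ : TraceAlgebra Γ →ₗ⁅ℤ⁆ U).comp (magnusLie Γ)) ?_
      rintro _ ⟨v, rfl⟩
      change _ = ψ (magnusLie Γ (LcsLie.deg1 (of v)))
      rw [magnusLie_deg1_of]
      exact (MonoidAlgebra.lift_of (R := ℤ) ψ₀ (TraceMonoid.of v)).symm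
    have hx : f x = 0 := by
      have hq0 : ((q : ℤ) : U) = 0 := by
        rw [← map_intCast (algebraMap (ZMod q) U)]
        simp
      rw [hf, h, map_zsmul, zsmul_eq_mul, hq0, zero_mul]
    exact exists_eq_smul_of_one_tmul_eq_zero
      (ι_injective_of_isSolvable (ZMod q) K (hx.trans (map_zero _).symm))
  refine LcsLie.exists_eq_smul_of_truncation key

/-! ### Purity of the image of `L` in the trace algebra -/

theorem traceAlgebra_smul_right_injective {n : ℤ} (hn : n ≠ 0) {X Y : TraceAlgebra Γ}
    (h : n • X = n • Y) : X = Y := by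
  refine MonoidAlgebra.ext (Finsupp.ext fun m => ?_)
  have := congrArg (fun Z : TraceAlgebra Γ => Z.coeff m) h
  exact mul_left_cancel₀ hn this

/-- Purity at an arbitrary `n > 0`: the map `ℤ/n ⊗ L → ℤ/n[M]` is injective. -/
theorem exists_eq_smul_of_magnusLie [Finite V] {n : ℕ} (hn : n ≠ 0) {x : LcsLie (RAAG Γ)}
    {Y : TraceAlgebra Γ} (h : magnusLie Γ x = (n : ℤ) • Y) : ∃ y, x = (n : ℤ) • y := by
  induction n using Nat.recOnMul generalizing x Y with
  | zero => exact (hn rfl).elim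
  | one => exact ⟨x, by simp⟩
  | prime q hq => exact exists_eq_prime_smul hq h
  | mul a b ha hb =>
    have ha0 := left_ne_zero_of_mul hn
    rw [Nat.cast_mul, mul_smul] at h
    obtain ⟨y, rfl⟩ := ha ha0 h
    rw [map_zsmul] at h
    obtain ⟨z, rfl⟩ := hb (right_ne_zero_of_mul hn)
      (traceAlgebra_smul_right_injective (Int.natCast_ne_zero.2 ha0) h)
    exact ⟨z, by rw [Nat.cast_mul, mul_smul]⟩

/-- `L_c → ℤ[M]` is injective: its kernel is a finitely generated abelian group which, by purity,
is divisible by every prime. -/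
theorem eq_zero_of_magnusLie_eq_zero [Finite V] {c : ℕ+} {x : LcsLie (RAAG Γ)}
    (hx : x ∈ LcsLie.degreePart (RAAG Γ) c) (h : magnusLie Γ x = 0) : x = 0 := by
  let K : Submodule ℤ (LcsLie (RAAG Γ)) := LcsLie.degreePart (RAAG Γ) c ⊓
    LinearMap.ker (magnusLie Γ : LcsLie (RAAG Γ) →ₗ[ℤ] TraceAlgebra Γ)
  have hfg : K.FG :=
    (LcsLie.degreePart_fg (Set.finite_range of) closure_range_of c).of_le inf_le_left
  have : Module.Finite ℤ K := Module.Finite.iff_fg.2 hfg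
  refine congrArg Subtype.val (eq_zero_of_forall_prime_divisible (K := K) ?_ ⟨x, hx, h⟩)
  rintro q hq ⟨_, ⟨a, rfl⟩, hy⟩
  change magnusLie Γ (LcsLie.of c a) = 0 at hy
  obtain ⟨z, hz⟩ := exists_eq_prime_smul (Y := 0) hq (hy.trans (smul_zero _).symm)
  have hz' : LcsLie.of c a = (q : ℤ) • LcsLie.of c (LcsLie.component (RAAG Γ) c z) := by
    rw [← map_zsmul, ← map_zsmul, ← hz, LcsLie.component_of_same]
  refine ⟨⟨LcsLie.of c (LcsLie.component (RAAG Γ) c z), ⟨_, rfl⟩, ?_⟩, Subtype.ext hz'⟩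
  change magnusLie Γ _ = 0
  refine traceAlgebra_smul_right_injective (Int.natCast_ne_zero.2 hq.ne_zero) ?_
  rw [← map_zsmul, ← hz', hy, smul_zero]

/-- An element of `L` that commutes modulo `n` with the generators has image divisible by `n`: its
reduction is central in `ℤ/n[M]`, hence constant, and it lies in the augmentation ideal. For `n = 0`
this says that the image vanishes. -/
theorem exists_magnusLie_eq_smul (hΓ : ∀ w, ∃ v, v ≠ w ∧ ¬ Γ.Adj v w) {n : ℕ}
    {x : LcsLie (RAAG Γ)} (hx : ∀ v, ∃ y, ⁅x, LcsLie.deg1 (of (Γ := Γ) v)⁆ = (n : ℤ) • y) :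
    ∃ Y, magnusLie Γ x = (n : ℤ) • Y := by
  let r := MonoidAlgebra.mapRingHom (TraceMonoid Γ) (Int.castRingHom (ZMod n))
  have hcomm : ∀ v, 
      Commute (r (magnusLie Γ x)) (MonoidAlgebra.of (ZMod n) _ (TraceMonoid.of v)) := by
    intro v
    obtain ⟨y, hy⟩ := hx v
    have h1 := congrArg (fun z => r (magnusLie Γ z)) hy
    have h2 : r (letter v) = MonoidAlgebra.of (ZMod n) _ (TraceMonoid.of v) := by
      simp [r, letter]
    have h3 : ((n : ℤ) : MonoidAlgebra (ZMod n) (TraceMonoid Γ)) = 0 := by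
      rw [← map_intCast (algebraMap (ZMod n) (MonoidAlgebra (ZMod n) (TraceMonoid Γ)))]
      simp
    simp only [LieHom.map_lie, map_zsmul, magnusLie_deg1_of, LieRing.of_associative_ring_bracket,
      map_sub, map_mul, h2] at h1
    rw [zsmul_eq_mul, h3, zero_mul, sub_eq_zero] at h1
    exact h1
  have hdvd : ∀ m, (n : ℤ) ∣ (magnusLie Γ x).coeff m := by
    intro m
    by_cases hm : m = 1
    · rw [hm, coeff_one_magnusLie]
      exact dvd_zero _
    · have := coeff_eq_zero_of_commute_of hΓ _ hcomm hm
      rw [MonoidAlgebra.coeff_mapRingHom] at this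
      exact (ZMod.intCast_zmod_eq_zero_iff_dvd _ _).1 this
  -- For `n = 0` all coefficients vanish, and the quotients by `0` below are `0` as they should be.
  refine ⟨MonoidAlgebra.ofCoeff
    ((magnusLie Γ x).coeff.mapRange (· / (n : ℤ)) (Int.zero_ediv _)), ?_⟩
  refine MonoidAlgebra.ext (Finsupp.ext fun m => ?_)
  exact (Int.mul_ediv_cancel' (hdvd m)).symm

/-- The homogeneous elements of `L` that commute with the generators vanish. -/
theorem eq_zero_of_lie_deg1_eq_zero [Finite V] (hΓ : ∀ w, ∃ v, v ≠ w ∧ ¬ Γ.Adj v w) {c : ℕ+}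
    {x : LcsLie (RAAG Γ)} (hx : x ∈ LcsLie.degreePart (RAAG Γ) c)
    (h : ∀ v, ⁅x, LcsLie.deg1 (of (Γ := Γ) v)⁆ = 0) : x = 0 := by
  obtain ⟨Y, hY⟩ := exists_magnusLie_eq_smul (n := 0) hΓ (x := x) fun v =>
    ⟨0, (h v).trans (smul_zero _).symm⟩
  exact eq_zero_of_magnusLie_eq_zero hx (hY.trans (by simp))

end RAAG

/-! ### Homogeneous components and the centres -/

namespace LcsLie

variable {G : Type*} [Group G]

theorem of_component_lie_deg1 (x : LcsLie G) (g : G) (c : ℕ+) :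
    of (c + 1) (component G (c + 1) ⁅x, deg1 g⁆) = ⁅of c (component G c x), deg1 g⁆ := by
  induction x using LcsLie.induction with
  | zero => simp only [zero_lie, map_zero]
  | add x y hx hy => simp only [add_lie, map_add, hx, hy]
  | of d a =>
    rw [deg1, lie_of_of]
    by_cases h : d = c
    · subst h
      rw [component_of_same, component_of_same, lie_of_of]
    · rw [component_of_ne h, component_of_ne fun e => h (add_right_cancel e), map_zero, map_zero,
        zero_lie]

theorem lie_mem_tail (x : LcsLie G) {y : LcsLie G} {c : ℕ+} (hy : y ∈ degreePart G c) :
    ⁅x, y⁆ ∈ tail G c := by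
  refine lie_mem_of_mem_iSup (s := {c}) (P := tailSubmodule G c) (fun i j hj => ?_) x ?_
  · rw [Set.mem_singleton_iff.1 hj]
    exact degreePart_le_tailSubmodule (PNat.lt_add_left c i)
  · rwa [iSup_singleton]

theorem sub_of_component_mem_tail {x : LcsLie G} {c : ℕ+}
    (h : ∀ d < c, of d (component G d x) = 0) : x - of c (component G c x) ∈ tail G c := by
  refine mem_of_of_component_mem (P := (tailSubmodule G c).toAddSubgroup) fun d => ?_
  change _ ∈ tailSubmodule G c
  rw [map_sub, map_sub]
  rcases lt_trichotomy d c with hd | rfl | hd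
  · rw [h d hd, component_of_ne hd.ne', map_zero, sub_zero]
    exact Submodule.zero_mem _
  · rw [component_of_same, sub_self]
    exact Submodule.zero_mem _
  · rw [component_of_ne hd.ne, map_zero, sub_zero]
    exact degreePart_le_tailSubmodule hd (of_mem_degreePart _)

end LcsLie

end

theorem theoremc {V : Type*} [Finite V] (Γ : SimpleGraph V)
    (hZ : Subgroup.center (RAAG Γ) = ⊥) :
    LieAlgebra.center ℤ (LcsLie (RAAG Γ)) = ⊥ ∧
    (∀ p : ℕ, 0 < p →
      LieAlgebra.center (ZMod p) (ZMod p ⊗[ℤ] LcsLie (RAAG Γ)) = ⊥) ∧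
    (∀ c : ℕ+,
      (LieAlgebra.center ℤ (LcsLie.Truncation (RAAG Γ) c)).toSubmodule =
        (LcsLie.degreePart (RAAG Γ) c).map (LcsLie.toTruncation (RAAG Γ) c)) := by
  have hΓ := RAAG.exists_not_adj_of_center_eq_bot hZ
  refine ⟨?_, fun p hp => ?_, fun c => ?_⟩
  · refine (LieSubmodule.eq_bot_iff _).2 fun x hx => ?_
    have hx' : ∀ g, ⁅x, LcsLie.deg1 g⁆ = 0 := fun g => by
      rw [← lie_skew, (LieModule.mem_maxTrivSubmodule _ _ _ _).1 hx, neg_zero]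
    refine AddSubgroup.mem_bot.1 (LcsLie.mem_of_of_component_mem (P := ⊥) fun d => ?_)
    refine AddSubgroup.mem_bot.2 (RAAG.eq_zero_of_lie_deg1_eq_zero hΓ
      (LcsLie.of_mem_degreePart _) fun v => ?_)
    rw [← LcsLie.of_component_lie_deg1, hx', map_zero, map_zero]
  · refine (LieSubmodule.eq_bot_iff _).2 fun z hz => ?_
    obtain ⟨x, rfl⟩ := exists_one_tmul_eq z
    obtain ⟨Y, hY⟩ := RAAG.exists_magnusLie_eq_smul (n := p) hΓ (x := x) fun v => by
      have := (LieModule.mem_maxTrivSubmodule _ _ _ _).1 hz (1 ⊗ₜ LcsLie.deg1 (RAAG.of v))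
      rw [← lie_skew, LieAlgebra.ExtendScalars.bracket_tmul, mul_one, neg_eq_zero] at this
      exact exists_eq_smul_of_one_tmul_eq_zero this
    obtain ⟨y, rfl⟩ := RAAG.exists_eq_smul_of_magnusLie hp.ne' hY
    rw [← TensorProduct.smul_tmul]
    simp
  · ext z
    obtain ⟨x, rfl⟩ := LcsLie.toTruncationHom_surjective c z
    rw [LieSubmodule.mem_toSubmodule, LieModule.mem_maxTrivSubmodule]
    refine ⟨fun hx => ?_, ?_⟩
    · have hx' : ∀ g, ⁅x, LcsLie.deg1 g⁆ ∈ LcsLie.tail (RAAG Γ) c := fun g => by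
        rw [← LcsLie.toTruncationHom_eq_zero, ← lie_skew, map_neg, LieHom.map_lie, hx, neg_zero]
      refine ⟨_, LcsLie.of_mem_degreePart (LcsLie.component _ c x), ?_⟩
      refine (sub_eq_zero.1 ?_).symm
      refine (map_sub (LcsLie.toTruncationHom (RAAG Γ) c) _ _).symm.trans
        (LcsLie.toTruncationHom_eq_zero.2 (LcsLie.sub_of_component_mem_tail fun d hd => ?_))
      refine RAAG.eq_zero_of_lie_deg1_eq_zero hΓ (LcsLie.of_mem_degreePart _) fun v => ?_
      rw [← LcsLie.of_component_lie_deg1,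
        LcsLie.component_eq_zero_of_mem_tail (PNat.add_one_le_iff.2 hd) (hx' _), map_zero]
    · rintro ⟨y, hy, hxy⟩ w
      obtain ⟨w, rfl⟩ := LcsLie.toTruncationHom_surjective c w
      change LcsLie.toTruncationHom (RAAG Γ) c y = _ at hxy
      rw [← hxy, ← LieHom.map_lie, LcsLie.toTruncationHom_eq_zero]
      exact LcsLie.lie_mem_tail w hy
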